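/- **Setting.** Let $d\ge 2$, let $G\subset U(N)$ be a compact connected matrix Lie group, and let $\mathfrak g$ be its Lie algebra (the tangent space at the identity), of dimension $n$, with the Hilbert–Schmidt inner product $\langle A,B\rangle=\mathrm{Tr}(AB^*)$ and $\|A\|^2=\langle A,A\rangle$. *Lattice field.* For $L\ge 0$ let $Q_L=[-L,L]^d\cap\mathbb Z^d$, and let $E(Q_L)$, $P(Q_L)$ be the positively oriented edges and the plaquettes contained in $Q_L$. For $\beta,\mu>0$ the $\mathfrak g$-valued lattice Proca field with free boundary conditions, mass parameter $\mu$ and inverse coupling $\beta$ is the random configuration $X\in\mathfrak g^{E(Q_L)}$ whose law has density proportional to $e^{-\beta S(X)}$ with respect to $\prod_{e\in E(Q_L)}\mathrm{Leb}(\mathrm dX_e)$, where $$S(X)=\frac12\sum_{p\in P(Q_L)}\|(\mathsf dX)_p\|^2+\frac{\mu}{2}\sum_{e\in E(Q_L)}\|X_e\|^2$$ and, for $p$ with corners $a,\ a+e_i,\ a+e_i+e_j,\ a+e_j$ $(i<j)$, $$(\mathsf dX)_p=X_{(a,a+e_i)}+X_{(a+e_i,a+e_i+e_j)}-X_{(a+e_j,a+e_i+e_j)}-X_{(a,a+e_j)}.$$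 Put $X_e=0$ for $e\notin E(Q_L)$. For $x\in\mathbb R^d$ let $v(x)$ be the point of $\mathbb Z^d$ closest to $x$ (the lexicographically smallest one in case of a tie). For $\varepsilon>0$ and $1\le j\le d$ put $$Z^{\mathfrak g,\varepsilon}_j(x)=\varepsilon^{-(d-2)/2}\sqrt\beta\,X_{(v(\varepsilon^{-1}x),\,v(\varepsilon^{-1}x)+e_j)},\qquad Z^{\mathfrak g,\varepsilon}(F)=\sum_{j=1}^d\int_{\mathbb R^d}\langle Z^{\mathfrak g,\varepsilon}_j(x),F_j(x)\rangle\,\mathrm dx$$ for $F=(F_1,\dots,F_d)\in\mathfrak D$, the space of compactly supported $C^\infty$ functions $\mathbb R^d\to\mathfrak g^d$. *Continuum field.* For $m>0$ and Schwartz 1-forms $F=(F_1,\dots,F_d)$ on $\mathbb R^d$ let $R_mF=(-\Delta+m)^{-1}\big(F-m^{-1}\nabla\,\mathrm{div}\,F\big)$ and $(F,H)=\sum_j\int F_jH_j\,\mathrm dx$. For an orthonormal basis $V_1,\dots,V_n$ of $\mathfrak g$ and $F\in\mathfrak D$ let $F^\ell_j=\langle F_j,V_\ell\rangle$. For the $\mathfrak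 g$-valued Proca field $\mathcal X_{\mathfrak g,m}$ of mass $m$ on $\mathbb R^d$, $\mathcal X_{\mathfrak g,m}(F)$ is a Gaussian random variable with mean $0$ and variance $\sum_{\ell=1}^n(F^\ell,R_mF^\ell)$ (which does not depend on the basis). **Proposition.** Let $m>0$, $\delta>0$, $C>0$. Let $\varepsilon\to0^+$ and $\beta\to\infty$ simultaneously so that $\beta^{-1}\le\varepsilon^{C}$. Let $L=\lfloor\varepsilon^{-1-\delta}\rfloor$, and let $Z^{\mathfrak g,\varepsilon}$ be induced by the $\mathfrak g$-valued lattice Proca field on $Q_L$ with free boundary conditions, mass parameter $\mu=\varepsilon^2m$ and inverse coupling $\beta$. Then, for every $F\in\mathfrak D$, $$Z^{\mathfrak g,\varepsilon}(F)\longrightarrow\mathcal X_{\mathfrak g,m}(F)\qquad\text{in law.}$$ -/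

import Mathlib

open MeasureTheory ProbabilityTheory Filter Topology
open scoped SchwartzMap ContDiff LineDeriv Laplacian ComplexOrder

noncomputable section

namespace Proca

/-! ### The Lie algebra of a matrix group -/

section LieAlgebra

variable {N : ℕ}

/-- The tangent space at the identity of a subgroup `G` of `U(N)`: the velocities at time `0` of the
smooth curves in `G` that start at the identity matrix (smoothness and derivatives of matrix-valued
curves are taken entrywise). -/
def tangentSpaceAtOne (G : Subgroup (Matrix.unitaryGroup (Fin N) ℂ)) :
    Submodule ℝ (Matrix (Fin N) (Fin N) ℂ) where
  carrier := {X | ∃ γ : ℝ → Matrix.unitaryGroup (Fin N) ℂ, (∀ t, γ t ∈ G) ∧ γ 0 = 1 ∧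
    (∀ i j, ContDiff ℝ ∞ fun t => (γ t : Matrix (Fin N) (Fin N) ℂ) i j) ∧
    ∀ i j, HasDerivAt (fun t => (γ t : Matrix (Fin N) (Fin N) ℂ) i j) (X i j) 0}
  zero_mem' := ⟨fun _ => 1, fun _ => G.one_mem, rfl, fun _ _ => contDiff_const,
    fun _ _ => hasDerivAt_const _ _⟩
  add_mem' := by
    rintro X Y ⟨γ, hγ, hγ0, hγs, hγd⟩ ⟨η, hη, hη0, hηs, hηd⟩
    refine ⟨fun t => γ t * η t, fun t => G.mul_mem (hγ t) (hη t), by simp [hγ0, hη0], ?_, ?_⟩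
    · intro i j
      simp only [Submonoid.coe_mul, Matrix.mul_apply]
      exact ContDiff.sum fun k _ => (hγs i k).mul (hηs k j)
    · intro i j
      simp only [Submonoid.coe_mul, Matrix.mul_apply]
      have h := HasDerivAt.fun_sum (u := Finset.univ) fun k _ => (hγd i k).mul (hηd k j)
      refine h.congr_deriv ?_
      simp [hγ0, hη0, Finset.sum_add_distrib, Matrix.one_apply]
  smul_mem' := by
    rintro c X ⟨γ, hγ, hγ0, hγs, hγd⟩
    refine ⟨fun t => γ (c * t), fun t => hγ _, by simp [hγ0], ?_, ?_⟩
    · intro i j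
      exact (hγs i j).comp (contDiff_const.mul contDiff_id)
    · intro i j
      have h1 : HasDerivAt (fun t : ℝ => c * t) c 0 := by
        simpa using (hasDerivAt_id (0 : ℝ)).const_mul c
      have h2 : HasDerivAt (fun t => (γ t : Matrix (Fin N) (Fin N) ℂ) i j) (X i j) (c * 0) := by
        simpa using hγd i j
      exact h2.scomp (0 : ℝ) h1

/-- The Lie algebra `𝔤` of `G`, as a real vector space of matrices. -/
def LieAlg (G : Subgroup (Matrix.unitaryGroup (Fin N) ℂ)) : Type := tangentSpaceAtOne G

variable (G : Subgroup (Matrix.unitaryGroup (Fin N) ℂ))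

instance : AddCommGroup (LieAlg G) := inferInstanceAs (AddCommGroup (tangentSpaceAtOne G))

instance : Module ℝ (LieAlg G) := inferInstanceAs (Module ℝ (tangentSpaceAtOne G))

instance : FiniteDimensional ℝ (LieAlg G) :=
  inferInstanceAs (FiniteDimensional ℝ (tangentSpaceAtOne G))

/-- The matrix underlying an element of the Lie algebra. -/
def LieAlg.toMatrix : LieAlg G →ₗ[ℝ] Matrix (Fin N) (Fin N) ℂ := (tangentSpaceAtOne G).subtype

/-- The Hilbert-Schmidt inner product `⟨A, B⟩ = Tr(A B*)` on `𝔤`. (The elements of `𝔤` are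
skew-Hermitian, so the trace is real; `re` only records this in the type.) -/
@[reducible] def hilbertSchmidtCore : InnerProductSpace.Core ℝ (LieAlg G) where
  inner A B := ((LieAlg.toMatrix G A * (LieAlg.toMatrix G B).conjTranspose).trace).re
  conj_inner_symm A B := by
    have h := Matrix.trace_conjTranspose
      (LieAlg.toMatrix G A * (LieAlg.toMatrix G B).conjTranspose)
    rw [Matrix.conjTranspose_mul, Matrix.conjTranspose_conjTranspose] at h
    simp [h]
  re_inner_nonneg A := by
    have h := (Matrix.posSemidef_self_mul_conjTranspose (LieAlg.toMatrix G A)).trace_nonneg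
    simpa using (Complex.le_def.1 h).1
  add_left A B C := by simp [Matrix.add_mul, Matrix.trace_add]
  smul_left A B r := by simp [Matrix.trace_smul]
  definite A h := by
    have h0 := (Matrix.posSemidef_self_mul_conjTranspose (LieAlg.toMatrix G A)).trace_nonneg
    have h1 : (LieAlg.toMatrix G A * (LieAlg.toMatrix G A).conjTranspose).trace = 0 :=
      Complex.ext (by simpa using h) (by simpa using (Complex.le_def.1 h0).2.symm)
    rw [Matrix.trace_mul_conjTranspose_self_eq_zero_iff] at h1
    exact Subtype.ext h1

instance : NormedAddCommGroup (LieAlg G) := (hilbertSchmidtCore G).toNormedAddCommGroup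

instance : InnerProductSpace ℝ (LieAlg G) := InnerProductSpace.ofCore (hilbertSchmidtCore G).toCore

instance : MeasurableSpace (LieAlg G) := borel _

instance : BorelSpace (LieAlg G) := ⟨rfl⟩

end LieAlgebra

/-! ### The Euclidean Proca covariance -/

section Continuum

/-- The Euclidean space `ℝ^d`. -/
abbrev Space (d : ℕ) : Type := EuclideanSpace ℝ (Fin d)

variable {d : ℕ}

/-- The standard basis vector `e_j` of `ℝ^d`. -/
def stdVec (j : Fin d) : Space d := EuclideanSpace.single j 1

/-- The symbol `ξ ↦ 1 / (4π²|ξ|² + m)` of the operator `(-Δ + m)⁻¹`. -/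
def massiveSymbol (d : ℕ) (m : ℝ) (ξ : Space d) : ℝ := ((2 * Real.pi) ^ 2 * ‖ξ‖ ^ 2 + m)⁻¹

/-- The operator `K_m = (-Δ + m)⁻¹` on real Schwartz functions, as a Fourier multiplier. See
`sub_laplacian_massiveInv` and `massiveInv_sub_laplacian`: it is the two-sided inverse of
`-Δ + m`. -/
def massiveInv (m : ℝ) : 𝓢(Space d, ℝ) →L[ℝ] 𝓢(Space d, ℝ) :=
  (SchwartzMap.postcompCLM Complex.reCLM) ∘L
    (SchwartzMap.fourierMultiplierCLM ℂ (massiveSymbol d m)) ∘L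
    (SchwartzMap.postcompCLM Complex.ofRealCLM)

theorem massiveInv_apply (m : ℝ) (f : 𝓢(Space d, ℝ)) : massiveInv m f =
    (SchwartzMap.fourierMultiplierCLM ℂ (massiveSymbol d m)
      (f.postcompCLM Complex.ofRealCLM)).postcompCLM Complex.reCLM := rfl

theorem massiveSymbol_hasTemperateGrowth {m : ℝ} (hm : 0 < m) :
    (massiveSymbol d m).HasTemperateGrowth := by
  have h1 : (fun x : Space d => (1 + ‖x‖ ^ 2) ^ (-1 : ℝ)).HasTemperateGrowth := by fun_prop
  let A : Space d →L[ℝ] Space d := (2 * Real.pi / √m) • ContinuousLinearMap.id ℝ _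
  have h2 : (fun x : Space d => m⁻¹ * (1 + ‖A x‖ ^ 2) ^ (-1 : ℝ)).HasTemperateGrowth :=
    (Function.HasTemperateGrowth.const m⁻¹).mul (h1.comp (A.hasTemperateGrowth))
  convert h2 using 2 with x
  have hA : ‖A x‖ ^ 2 = (2 * Real.pi) ^ 2 * ‖x‖ ^ 2 / m := by
    simp only [A, smul_apply, ContinuousLinearMap.id_apply, norm_smul,
      Real.norm_eq_abs, mul_pow, sq_abs, div_pow, Real.sq_sqrt hm.le]
    ring
  rw [hA, Real.rpow_neg_one, massiveSymbol, ← mul_inv]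
  congr 1
  field_simp
  ring

theorem fourierMultiplier_add_laplacian {m : ℝ} (g : 𝓢(Space d, ℂ)) :
    m • g - Δ g = SchwartzMap.fourierMultiplierCLM ℂ
      (fun ξ : Space d => (2 * Real.pi) ^ 2 * ‖ξ‖ ^ 2 + m) g := by
  rw [SchwartzMap.laplacian_eq_fourierMultiplierCLM]
  have h1 : (fun ξ : Space d => (2 * Real.pi) ^ 2 * ‖ξ‖ ^ 2 + m) =
      fun ξ => ∑ b : Bool, (fun (b : Bool) (ξ : Space d) =>
        if b then (2 * Real.pi) ^ 2 * ‖ξ‖ ^ 2 else m) b ξ := by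
    ext ξ; simp
  rw [h1, SchwartzMap.fourierMultiplierCLM_sum]
  · have h2 : (fun ξ : Space d => (2 * Real.pi) ^ 2 * ‖ξ‖ ^ 2) =
      ((2 * Real.pi) ^ 2 : ℝ) • (fun ξ : Space d => ‖ξ‖ ^ 2) := by ext; simp
    simp only [Fintype.sum_bool, if_true, Bool.false_eq_true, if_false,
      SchwartzMap.fourierMultiplierCLM_const]
    rw [h2, SchwartzMap.fourierMultiplierCLM_smul (by fun_prop)]
    ext x
    simp only [sub_apply, smul_apply, add_apply, ContinuousLinearMap.id_apply]
    module
  · intro b _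
    cases b
    · simp only [Bool.false_eq_true, if_false]; fun_prop
    · simp only [if_true]
      exact (Function.HasTemperateGrowth.const _).mul (by fun_prop)

theorem lineDeriv_postcomp {F₁ F₂ : Type*} [NormedAddCommGroup F₁] [NormedSpace ℝ F₁]
    [NormedAddCommGroup F₂] [NormedSpace ℝ F₂] (A : F₁ →L[ℝ] F₂) (f : 𝓢(Space d, F₁))
    (v : Space d) : ∂_{v} (f.postcompCLM A) = (∂_{v} f).postcompCLM A := by
  ext x
  simp only [SchwartzMap.lineDerivOp_apply_eq_fderiv, SchwartzMap.postcompCLM_apply]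
  have h : HasFDerivAt (f.postcompCLM A : 𝓢(Space d, F₂)) (A.comp (fderiv ℝ f x)) x :=
    A.hasFDerivAt.comp x (f.hasFDerivAt x)
  rw [h.fderiv]; rfl

theorem laplacian_postcomp {F₁ F₂ : Type*} [NormedAddCommGroup F₁] [NormedSpace ℝ F₁]
    [NormedAddCommGroup F₂] [NormedSpace ℝ F₂] (A : F₁ →L[ℝ] F₂) (f : 𝓢(Space d, F₁)) :
    Δ (f.postcompCLM A) = (Δ f).postcompCLM A := by
  simp only [SchwartzMap.laplacian_eq_sum (stdOrthonormalBasis ℝ (Space d)), lineDeriv_postcomp,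
    map_sum]

/-- `(-Δ + m) K_m f = f`. -/
theorem sub_laplacian_massiveInv {m : ℝ} (hm : 0 < m) (f : 𝓢(Space d, ℝ)) :
    m • massiveInv m f - Δ (massiveInv m f) = f := by
  rw [massiveInv_apply, laplacian_postcomp, ← map_smul, ← map_sub, fourierMultiplier_add_laplacian,
    SchwartzMap.fourierMultiplierCLM_fourierMultiplierCLM_apply (by fun_prop)
      (massiveSymbol_hasTemperateGrowth hm)]
  have : ((fun ξ : Space d => (2 * Real.pi) ^ 2 * ‖ξ‖ ^ 2 + m) * massiveSymbol d m) =
      fun _ => 1 := by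
    ext ξ
    simp only [Pi.mul_apply, massiveSymbol]
    exact mul_inv_cancel₀ (by positivity)
  rw [this, SchwartzMap.fourierMultiplierCLM_const]
  ext x; simp

/-- `K_m (-Δ + m) f = f`. -/
theorem massiveInv_sub_laplacian {m : ℝ} (hm : 0 < m) (f : 𝓢(Space d, ℝ)) :
    massiveInv m (m • f - Δ f) = f := by
  rw [massiveInv_apply, map_sub, map_smul, ← laplacian_postcomp, fourierMultiplier_add_laplacian,
    SchwartzMap.fourierMultiplierCLM_fourierMultiplierCLM_apply
      (massiveSymbol_hasTemperateGrowth hm) (by fun_prop)]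
  have : (massiveSymbol d m * (fun ξ : Space d => (2 * Real.pi) ^ 2 * ‖ξ‖ ^ 2 + m)) =
      fun _ => 1 := by
    ext ξ
    simp only [Pi.mul_apply, massiveSymbol]
    exact inv_mul_cancel₀ (by positivity)
  rw [this, SchwartzMap.fourierMultiplierCLM_const]
  ext x; simp

/-- The divergence of a Schwartz 1-form. -/
def divergence (F : Fin d → 𝓢(Space d, ℝ)) : 𝓢(Space d, ℝ) := ∑ i, ∂_{stdVec i} (F i)

/-- The Proca covariance operator `R_m F = K_m (F - m⁻¹ ∇ div F)` on Schwartz 1-forms. -/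
def procaOp (m : ℝ) (F : Fin d → 𝓢(Space d, ℝ)) : Fin d → 𝓢(Space d, ℝ) := fun j =>
  massiveInv m (F j - m⁻¹ • ∂_{stdVec j} (divergence F))

/-- The inner product `(F, G) = ∑ⱼ ∫ Fⱼ Gⱼ` of Schwartz 1-forms. -/
def formInner (F G : Fin d → 𝓢(Space d, ℝ)) : ℝ := ∑ j, ∫ x, F j x * G j x

theorem integral_mul_massiveInv_nonneg {m : ℝ} (hm : 0 < m) (f : 𝓢(Space d, ℝ)) :
    0 ≤ ∫ x, f x * massiveInv m f x := by
  set g := massiveInv m f with hg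
  have hf : f = m • g - Δ g := (sub_laplacian_massiveInv hm f).symm
  let b := stdOrthonormalBasis ℝ (Space d)
  have hint : ∀ u v : 𝓢(Space d, ℝ), Integrable fun x => u x * v x := fun u v =>
    (SchwartzMap.pairing (ContinuousLinearMap.mul ℝ ℝ) u v).integrable
  have h1 : ∫ x, f x * g x = m * (∫ x, g x * g x) + ∑ i, ∫ x, ∂_{b i} g x * ∂_{b i} g x := by
    have h2 : ∀ x, f x * g x = m * (g x * g x) - ∑ i, g x * ∂_{b i} (∂_{b i} g) x := by
      intro x
      rw [hf, SchwartzMap.laplacian_eq_sum b]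
      simp only [sub_apply, smul_apply, smul_eq_mul, sum_apply, ← Finset.mul_sum]
      ring
    simp_rw [h2]
    rw [integral_sub ((hint g g).const_mul m) (integrable_finsetSum _ fun i _ => hint _ _),
      integral_const_mul, integral_finsetSum _ fun i _ => hint _ _]
    simp_rw [SchwartzMap.integral_mul_lineDerivOp_right_eq_neg_left]
    rw [Finset.sum_neg_distrib, sub_neg_eq_add]
  rw [h1]
  have h3 : ∀ u : 𝓢(Space d, ℝ), 0 ≤ ∫ x, u x * u x := fun u =>
    integral_nonneg fun x => mul_self_nonneg _
  exact add_nonneg (mul_nonneg hm.le (h3 g)) (Finset.sum_nonneg fun i _ => h3 _)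

theorem massiveInv_lineDeriv {m : ℝ} (hm : 0 < m) (f : 𝓢(Space d, ℝ)) (v : Space d) :
    massiveInv m (∂_{v} f) = ∂_{v} (massiveInv m f) := by
  have hs := massiveSymbol_hasTemperateGrowth (d := d) hm
  rw [massiveInv_apply, massiveInv_apply, lineDeriv_postcomp, ← lineDeriv_postcomp]
  congr 1
  rw [SchwartzMap.lineDeriv_eq_fourierMultiplierCLM, SchwartzMap.lineDeriv_eq_fourierMultiplierCLM,
    ← SchwartzMap.fourierMultiplierCLM_ofReal ℂ hs, map_smul,
    SchwartzMap.fourierMultiplierCLM_ofReal ℂ hs,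
    SchwartzMap.fourierMultiplierCLM_fourierMultiplierCLM_apply hs (by fun_prop),
    SchwartzMap.fourierMultiplierCLM_fourierMultiplierCLM_apply (by fun_prop) hs,
    mul_comm (massiveSymbol d m)]

/-- The quadratic form `F ↦ (F, R_m F)` is nonnegative, so it is a variance. -/
theorem formInner_procaOp_nonneg {m : ℝ} (hm : 0 < m) (F : Fin d → 𝓢(Space d, ℝ)) :
    0 ≤ formInner F (procaOp m F) := by
  have hint : ∀ u v : 𝓢(Space d, ℝ), Integrable fun x => u x * v x := fun u v =>
    (SchwartzMap.pairing (ContinuousLinearMap.mul ℝ ℝ) u v).integrable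
  have h1 : ∀ j, ∫ x, F j x * procaOp m F j x = (∫ x, F j x * massiveInv m (F j) x) +
      m⁻¹ * ∫ x, ∂_{stdVec j} (F j) x * massiveInv m (divergence F) x := by
    intro j
    have h2 : ∀ x, F j x * procaOp m F j x = F j x * massiveInv m (F j) x -
        m⁻¹ * (F j x * ∂_{stdVec j} (massiveInv m (divergence F)) x) := by
      intro x
      rw [procaOp, map_sub, map_smul, massiveInv_lineDeriv hm]
      simp only [sub_apply, smul_apply, smul_eq_mul]
      ring
    simp_rw [h2]
    rw [integral_sub (hint _ _) ((hint _ _).const_mul _), integral_const_mul,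
      SchwartzMap.integral_mul_lineDerivOp_right_eq_neg_left]
    ring
  have h : formInner F (procaOp m F) = (∑ j, ∫ x, F j x * massiveInv m (F j) x) +
      m⁻¹ * ∫ x, divergence F x * massiveInv m (divergence F) x := by
    have h3 : ∫ x, divergence F x * massiveInv m (divergence F) x =
        ∑ j, ∫ x, ∂_{stdVec j} (F j) x * massiveInv m (divergence F) x := by
      rw [← integral_finsetSum _ fun i _ => hint _ _]
      congr 1
      ext x
      rw [← Finset.sum_mul]
      congr 1
      simp [divergence, sum_apply]
    rw [h3, formInner, Finset.mul_sum, ← Finset.sum_add_distrib]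
    exact Finset.sum_congr rfl fun j _ => h1 j
  rw [h]
  exact add_nonneg (Finset.sum_nonneg fun j _ => integral_mul_massiveInv_nonneg hm _)
    (mul_nonneg (inv_nonneg.2 hm.le) (integral_mul_massiveInv_nonneg hm _))

end Continuum

/-! ### The lattice Proca field with free boundary conditions -/

section Lattice

variable {d : ℕ}

/-- The box `Q_L = [-L, L]^d ∩ ℤ^d`. -/
def box (d L : ℕ) : Finset (Fin d → ℤ) := Fintype.piFinset fun _ => Finset.Icc (-(L : ℤ)) L

/-- The neighbour `a + e_i` of the lattice point `a`. -/
def shift (a : Fin d → ℤ) (i : Fin d) : Fin d → ℤ := a + Pi.single i 1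

/-- The edges of `Q_L`: the pair `(a, i)` stands for the positively oriented edge
`(a, a + e_i)`, both ends of which have to lie in `Q_L`. -/
def edges (d L : ℕ) : Finset ((Fin d → ℤ) × Fin d) :=
  (box d L ×ˢ Finset.univ).filter fun e => shift e.1 e.2 ∈ box d L

/-- The plaquettes of `Q_L`: `(a, i, j)` with `i < j` stands for the unit square with corners
`a`, `a + e_i`, `a + e_i + e_j`, `a + e_j`, all of which have to lie in `Q_L`. -/
def plaquettes (d L : ℕ) : Finset ((Fin d → ℤ) × Fin d × Fin d) :=
  (box d L ×ˢ Finset.univ ×ˢ Finset.univ).filter fun p =>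
    p.2.1 < p.2.2 ∧ shift p.1 p.2.1 ∈ box d L ∧ shift p.1 p.2.2 ∈ box d L ∧
      shift (shift p.1 p.2.1) p.2.2 ∈ box d L

variable {V : Type*} [NormedAddCommGroup V]

/-- The extension of an edge configuration on `Q_L` to all edges of `ℤ^d` by `0`. -/
def extend {L : ℕ} (X : edges d L → V) (e : (Fin d → ℤ) × Fin d) : V :=
  if h : e ∈ edges d L then X ⟨e, h⟩ else 0

/-- `(dX)_p = X_{e₁} + X_{e₂} - X_{e₃} - X_{e₄}` for the plaquette `p = (a, i, j)` with edges
`e₁ = (a, a + e_i)`, `e₂ = (a + e_i, a + e_i + e_j)`, `e₃ = (a + e_j, a + e_i + e_j)`,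
`e₄ = (a, a + e_j)`. -/
def curl {L : ℕ} (X : edges d L → V) (p : (Fin d → ℤ) × Fin d × Fin d) : V :=
  extend X (p.1, p.2.1) + extend X (shift p.1 p.2.1, p.2.2)
    - extend X (shift p.1 p.2.2, p.2.1) - extend X (p.1, p.2.2)

/-- The Gaussian action `S(X) = ½ ∑_p ‖(dX)_p‖² + (m/2) ∑_e ‖X_e‖²`. -/
def action {L : ℕ} (m : ℝ) (X : edges d L → V) : ℝ :=
  1 / 2 * ∑ p ∈ plaquettes d L, ‖curl X p‖ ^ 2 + m / 2 * ∑ e, ‖X e‖ ^ 2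

theorem continuous_extend {L : ℕ} (e : (Fin d → ℤ) × Fin d) :
    Continuous fun X : edges d L → V => extend X e := by
  unfold extend
  split_ifs
  · exact continuous_apply _
  · exact continuous_const

theorem continuous_action {L : ℕ} (m : ℝ) :
    Continuous fun X : edges d L → V => action m X := by
  unfold action curl
  have := continuous_extend (V := V) (d := d) (L := L)
  fun_prop

variable [InnerProductSpace ℝ V] [FiniteDimensional ℝ V] [MeasurableSpace V] [BorelSpace V]

theorem integrable_exp_neg_action (L : ℕ) {β m : ℝ} (hβ : 0 < β) (hm : 0 < m) :
    Integrable fun X : edges d L → V => Real.exp (-β * action m X) := by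
  have hb : 0 < β * (m / 2) := by positivity
  have h1 : Integrable fun v : V => Real.exp (-(β * (m / 2)) * ‖v‖ ^ 2) := by
    have h := (GaussianFourier.integrable_cexp_neg_mul_sq_norm_add (V := V)
      (b := ((β * (m / 2) : ℝ) : ℂ)) (by simpa using hb) 0 0).norm
    refine h.congr (Eventually.of_forall fun v => ?_)
    simp only [Complex.norm_exp, zero_mul, add_zero]
    norm_cast
  have h2 : Integrable fun X : edges d L → V =>
      ∏ e, Real.exp (-(β * (m / 2)) * ‖X e‖ ^ 2) :=
    Integrable.fintype_prod (f := fun _ v => Real.exp (-(β * (m / 2)) * ‖v‖ ^ 2)) fun _ => h1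
  refine h2.mono' ((continuous_action m).const_mul (-β)).rexp.aestronglyMeasurable
    (Eventually.of_forall fun X => ?_)
  rw [Real.norm_eq_abs, Real.abs_exp, ← Real.exp_sum, ← Finset.mul_sum, Real.exp_le_exp, action]
  have : 0 ≤ β * (1 / 2 * ∑ p ∈ plaquettes d L, ‖curl X p‖ ^ 2) := by positivity
  linarith

/-- The `V`-valued lattice Proca field on `Q_L` with free boundary conditions, mass parameter `m`
and inverse coupling `β`: the probability measure on edge configurations whose density with respect
to the product of Lebesgue measures is proportional to `exp (-β S(X))`. -/
def latticeProca (d L : ℕ) (V : Type*) [NormedAddCommGroup V] [InnerProductSpace ℝ V]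
    [FiniteDimensional ℝ V] [MeasurableSpace V] [BorelSpace V] {β m : ℝ} (hβ : 0 < β)
    (hm : 0 < m) : ProbabilityMeasure (edges d L → V) :=
  ⟨(volume : Measure (edges d L → V)).tilted fun X => -β * action m X,
    isProbabilityMeasure_tilted (integrable_exp_neg_action L hβ hm)⟩

/-- The lattice point `v(x)` closest to `x`, the lexicographically smallest one in case of a tie.
(The closest points form a product of sets with one or two elements, so ties are broken downward
in each coordinate.) -/
def nearestSite (x : Space d) : Fin d → ℤ := fun i => ⌈x i - 1 / 2⌉

/-- The random field `Z_j(x) = √β X_{(v(x), v(x) + e_j)}`. -/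
def latticeForm {L : ℕ} (β : ℝ) (X : edges d L → V) (j : Fin d) (x : Space d) : V :=
  √β • extend X (nearestSite x, j)

/-- The rescaled field `Z^ε(x) = ε^{-(d-2)/2} Z(ε⁻¹ x)`. -/
def rescaledForm {L : ℕ} (ε β : ℝ) (X : edges d L → V) (j : Fin d) (x : Space d) : V :=
  ε ^ (-((d : ℝ) - 2) / 2) • latticeForm β X j (ε⁻¹ • x)

end Lattice

/-! ### Test forms -/

section TestForm

/-- The space `𝔇` of smooth compactly supported `V`-valued 1-forms `F = (F_1, …, F_d)`
on `ℝ^d`. -/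
structure TestForm (d : ℕ) (V : Type*) [NormedAddCommGroup V] [InnerProductSpace ℝ V] where
  /-- The components of the form. -/
  toFun : Fin d → Space d → V
  smooth : ∀ j, ContDiff ℝ ∞ (toFun j)
  compactSupport : ∀ j, HasCompactSupport (toFun j)

variable {d n : ℕ} {V : Type*} [NormedAddCommGroup V] [InnerProductSpace ℝ V]

/-- The coordinate `F^ℓ_j(x) = ⟨F_j(x), V_ℓ⟩` with respect to an orthonormal basis. -/
def TestForm.coord (F : TestForm d V) (b : OrthonormalBasis (Fin n) ℝ V) (l : Fin n) :
    Fin d → 𝓢(Space d, ℝ) := fun j =>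
  HasCompactSupport.toSchwartzMap (f := fun x => inner ℝ (F.toFun j x) (b l))
    ((F.compactSupport j).comp_left (g := fun v => inner ℝ v (b l)) (inner_zero_left _))
    ((F.smooth j).inner ℝ contDiff_const)

/-- The pairing `Z^ε(F) = ∑ⱼ ∫ ⟨Z^ε_j(x), F_j(x)⟩ dx` of the rescaled lattice field with `F`. -/
def rescaledPairing {L : ℕ} (ε β : ℝ) (F : TestForm d V) (X : edges d L → V) : ℝ :=
  ∑ j, ∫ x, inner ℝ (rescaledForm ε β X j x) (F.toFun j x)

/-- The variance `∑_ℓ (F^ℓ, R_m F^ℓ)` of the `V`-valued Proca field tested against `F`. -/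
def procaVariance (m : ℝ) (b : OrthonormalBasis (Fin n) ℝ V) (F : TestForm d V) : ℝ :=
  ∑ l, formInner (F.coord b l) (procaOp m (F.coord b l))

theorem procaVariance_nonneg {m : ℝ} (hm : 0 < m) (b : OrthonormalBasis (Fin n) ℝ V)
    (F : TestForm d V) : 0 ≤ procaVariance m b F :=
  Finset.sum_nonneg fun _ _ => formInner_procaOp_nonneg hm _

/-- The law of `𝒳_m(F)`, where `𝒳_m` is the `V`-valued Euclidean Proca field of mass `m`: the
Gaussian law with mean `0` and variance `∑_ℓ (F^ℓ, R_m F^ℓ)`. -/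
def procaLaw {m : ℝ} (hm : 0 < m) (b : OrthonormalBasis (Fin n) ℝ V) (F : TestForm d V) :
    Measure ℝ :=
  gaussianReal 0 ⟨procaVariance m b F, procaVariance_nonneg hm b F⟩

instance {m : ℝ} (hm : 0 < m) (b : OrthonormalBasis (Fin n) ℝ V) (F : TestForm d V) :
    IsProbabilityMeasure (procaLaw hm b F) :=
  instIsProbabilityMeasureGaussianReal 0 _

end TestForm

end Proca

end

/-! The lattice field is Gaussian, so only a variance has to be computed. Write `S(X) = B(X, X) /
2`. If `f` is a linear functional and `B(Y, ·) = f`, then `f(X)` is centred Gaussian with variance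
`f(Y) / β` (`map_latticeProca`). The pairing with `F` is `√β • f` with `f` free of `β`, so its
variance is exactly `f(Y)`, and it remains to show `f(Y) → (F, R_m F)`. Only the Euclidean structure
of the Lie algebra plays a role.

The equation `B(Y, ·) = f` is the finite difference version, with free boundary, of `(d*d + m) U =
F`, whose solution is `U = R_m F` (`procaDiffOp_procaOp`). No lattice Green function is needed:
convergence is consistency plus stability. Cut `U` off to a form `W` of compact support, at an `L²`
cost as small as desired in the equation (`exists_cutoff`), and sample `W` on the lattice to get
`u`. Since `ε L → ∞`, the support of `u` stays away from the boundary of the box. Summation by parts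
then has no boundary terms, and `B(u, ·)` is the pairing with the finite difference operator applied
to `W` (`actionForm_discretize`). Taylor expansion shows that this is close to `(d*d + m) W`
(`tendsto_l2norm_procaDiff`).

For stability put `Z = Y - u`. Then `B(Z, ·)` is the pairing with the residual, of `L²` size `K`,
and the mass term gives `ε² m ‖Z‖² ≤ B(Z, Z) ≤ ε ‖Z‖ K`. Hence `ε ‖Z‖ ≤ K / m`, which bounds `f(Y) -
f(u)` by a multiple of `K` (`abs_pairingLin_sub_le`). Finally `f(u)` is a Riemann-type approximation
of `(W, F)`, and `(W, F) = (U, F)` because `W = U` on the support of `F`. -/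

noncomputable section

namespace Proca

/-! ### Linear functionals of the lattice field are Gaussian -/

section GaussianLaw

variable {d L : ℕ} {V : Type*} [NormedAddCommGroup V]

theorem extend_add (X Y : edges d L → V) (e : (Fin d → ℤ) × Fin d) :
    extend (X + Y) e = extend X e + extend Y e := by
  unfold extend; split_ifs <;> simp

theorem curl_add (X Y : edges d L → V) (p : (Fin d → ℤ) × Fin d × Fin d) :
    curl (X + Y) p = curl X p + curl Y p := by
  simp only [curl, extend_add]; abel

variable [InnerProductSpace ℝ V]

theorem extend_smul (c : ℝ) (X : edges d L → V) (e : (Fin d → ℤ) × Fin d) :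
    extend (c • X) e = c • extend X e := by
  unfold extend; split_ifs <;> simp

theorem curl_smul (c : ℝ) (X : edges d L → V) (p : (Fin d → ℤ) × Fin d × Fin d) :
    curl (c • X) p = c • curl X p := by
  simp only [curl, extend_smul, smul_add, smul_sub]

/-- The symmetric bilinear form `B` with `S(X) = B(X, X) / 2`. -/
def actionForm (d L : ℕ) (V : Type*) [NormedAddCommGroup V] [InnerProductSpace ℝ V] (m : ℝ) :
    LinearMap.BilinForm ℝ (edges d L → V) :=
  LinearMap.mk₂ ℝ
    (fun X Y => ∑ p ∈ plaquettes d L, inner ℝ (curl X p) (curl Y p) + m * ∑ e, inner ℝ (X e) (Y e))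
    (fun X X' Y => by
      simp only [curl_add, inner_add_left, Finset.sum_add_distrib, Pi.add_apply]; ring)
    (fun c X Y => by
      simp only [curl_smul, inner_smul_left, ← Finset.mul_sum, Pi.smul_apply, smul_eq_mul,
        RCLike.conj_to_real]; ring)
    (fun X Y Y' => by
      simp only [curl_add, inner_add_right, Finset.sum_add_distrib, Pi.add_apply]; ring)
    (fun c X Y => by
      simp only [curl_smul, inner_smul_right, ← Finset.mul_sum, Pi.smul_apply, smul_eq_mul]; ring)

theorem actionForm_apply (m : ℝ) (X Y : edges d L → V) : actionForm d L V m X Y =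
    ∑ p ∈ plaquettes d L, inner ℝ (curl X p) (curl Y p) + m * ∑ e, inner ℝ (X e) (Y e) := rfl

theorem actionForm_comm (m : ℝ) (X Y : edges d L → V) :
    actionForm d L V m X Y = actionForm d L V m Y X := by
  simp only [actionForm_apply, real_inner_comm]

theorem action_eq_actionForm (m : ℝ) (X : edges d L → V) :
    action m X = actionForm d L V m X X / 2 := by
  simp only [action, actionForm_apply, real_inner_self_eq_norm_sq]; ring

theorem mul_sum_norm_sq_le_actionForm (m : ℝ) (X : edges d L → V) :
    m * ∑ e, ‖X e‖ ^ 2 ≤ actionForm d L V m X X := by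
  simp only [actionForm_apply, real_inner_self_eq_norm_sq]
  have : 0 ≤ ∑ p ∈ plaquettes d L, ‖curl X p‖ ^ 2 := by positivity
  linarith

variable [FiniteDimensional ℝ V]

/-- Linear functionals are represented by the action form. -/
theorem exists_actionForm_eq {m : ℝ} (hm : 0 < m) (f : (edges d L → V) →ₗ[ℝ] ℝ) :
    ∃ Y, actionForm d L V m Y = f := by
  -- The mass term makes the form positive definite; injectivity into the dual space of the same
  -- dimension then gives surjectivity.
  have hinj : Function.Injective (actionForm d L V m) := by
    rw [← LinearMap.ker_eq_bot, LinearMap.ker_eq_bot']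
    intro X hX
    have h1 := mul_sum_norm_sq_le_actionForm m X
    rw [hX, LinearMap.zero_apply] at h1
    have h2 : ∑ e, ‖X e‖ ^ 2 = 0 :=
      le_antisymm (nonpos_of_mul_nonpos_right h1 hm) (by positivity)
    rw [Finset.sum_eq_zero_iff_of_nonneg fun _ _ => by positivity] at h2
    ext1 e
    simpa using h2 e (Finset.mem_univ e)
  exact (LinearMap.injective_iff_surjective_of_finrank_eq_finrank
    (Subspace.dual_finrank_eq (K := ℝ) (V := edges d L → V)).symm).1 hinj f

variable [MeasurableSpace V] [BorelSpace V]

/-- Completing the square: translating `X` by `(t / β) • Y` turns `-β S + t f` into `-β S` plus the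
constant `t² f(Y) / (2β)`, and Lebesgue measure is translation invariant. -/
theorem mgf_latticeProca {β m : ℝ} (hβ : 0 < β) (hm : 0 < m) {f : (edges d L → V) →ₗ[ℝ] ℝ}
    {Y : edges d L → V} (hY : actionForm d L V m Y = f) (t : ℝ) :
    mgf f (latticeProca d L V hβ hm : Measure _) t = Real.exp (f Y / β * t ^ 2 / 2) := by
  have hint : 0 < ∫ X : edges d L → V, Real.exp (-β * action m X) :=
    integral_exp_pos (integrable_exp_neg_action L hβ hm)
  have hf : ∀ X, actionForm d L V m Y X = f X := fun X => by rw [hY]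
  have hshift : ∀ X, (-β * action m (X + (t / β) • Y) + t * f (X + (t / β) • Y)) =
      f Y / β * t ^ 2 / 2 + -β * action m X := by
    intro X
    simp only [action_eq_actionForm, map_add, map_smul, LinearMap.add_apply, LinearMap.smul_apply,
      smul_eq_mul, actionForm_comm m X Y, hf]
    field_simp
    ring
  have h := integral_exp_tilted (μ := (volume : Measure (edges d L → V)))
    (fun X => -β * action m X) (fun X => t * f X)
  rw [mgf]
  refine h.trans ?_
  rw [← integral_add_right_eq_self _ ((t / β) • Y)]
  simp only [Pi.add_apply, hshift]
  simp only [Real.exp_add]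
  rw [integral_const_mul, mul_div_assoc, div_self hint.ne', mul_one]

/-- The Gaussian moment generating function is finite on all of `ℝ`, so it determines the complex
one and hence the law. -/
theorem map_latticeProca {β m : ℝ} (hβ : 0 < β) (hm : 0 < m) {f : (edges d L → V) →ₗ[ℝ] ℝ}
    {Y : edges d L → V} (hY : actionForm d L V m Y = f) :
    (latticeProca d L V hβ hm : Measure _).map f = gaussianReal 0 (f Y / β).toNNReal := by
  have h0 : 0 ≤ f Y / β := by
    refine div_nonneg ?_ hβ.le
    rw [← hY]
    exact (by positivity : 0 ≤ m * ∑ e, ‖Y e‖ ^ 2).trans (mul_sum_norm_sq_le_actionForm m Y)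
  have hmgf : mgf id (gaussianReal 0 (f Y / β).toNNReal) =
      mgf f (latticeProca d L V hβ hm : Measure _) := by
    ext t
    rw [mgf_id_gaussianReal, mgf_latticeProca hβ hm hY, Real.coe_toNNReal _ h0]
    simp
  have h := eqOn_complexMGF_of_mgf hmgf
  have hfm : Measurable f := (LinearMap.continuous_of_finiteDimensional f).measurable
  have := Measure.ext_of_complexMGF_eq aemeasurable_id hfm.aemeasurable
    (funext fun z => h (x := z) (by simp))
  simpa using this.symm

end GaussianLaw

/-! ### Convergence of variances implies convergence in law -/

section Convergence

/-- Every centred Gaussian is `√v` times a standard one, so dominated convergence applies, also at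
the degenerate value `v = 0`. -/
theorem continuous_gaussianReal_var (f : BoundedContinuousFunction ℝ ℝ) :
    Continuous fun v : ℝ => ∫ x, f x ∂gaussianReal 0 v.toNNReal := by
  have h : ∀ v : ℝ, ∫ x, f x ∂gaussianReal 0 v.toNNReal =
      ∫ x, f (√v * x) ∂gaussianReal 0 1 := by
    intro v
    rw [← integral_map (φ := fun x => √v * x) (by fun_prop) f.continuous.aestronglyMeasurable,
      gaussianReal_map_const_mul]
    congr 2
    · simp
    · ext
      -- For `v ≤ 0` both `v.toNNReal` and `√v` vanish.
      rcases le_total 0 v with hv | hv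
      · simp [hv]
      · simp [hv, Real.sqrt_eq_zero_of_nonpos hv]
  simp_rw [h]
  refine continuous_of_dominated (bound := fun _ => ‖f‖) ?_ ?_ (integrable_const _) ?_
  · intro v
    exact (f.continuous.comp (by fun_prop)).aestronglyMeasurable
  · intro v
    exact Eventually.of_forall fun x => f.norm_coe_le_norm _
  · exact Eventually.of_forall fun x => f.continuous.comp (by fun_prop)

theorem tendstoInDistribution_of_map_eq_gaussianReal {ι : Type*} {l : Filter ι} {Ω : ι → Type*}
    [∀ i, MeasurableSpace (Ω i)] {μ : ∀ i, Measure (Ω i)} [∀ i, IsProbabilityMeasure (μ i)]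
    {X : ∀ i, Ω i → ℝ} (hX : ∀ i, AEMeasurable (X i) (μ i)) {q : ι → ℝ}
    (hq : ∀ i, (μ i).map (X i) = gaussianReal 0 (q i).toNNReal) {v : ℝ} (hv : Tendsto q l (𝓝 v))
    {ν : Measure ℝ} [IsProbabilityMeasure ν] (hν : ν = gaussianReal 0 v.toNNReal) :
    TendstoInDistribution X l (id : ℝ → ℝ) μ ν where
  forall_aemeasurable := hX
  aemeasurable_limit := aemeasurable_id
  tendsto := by
    refine ProbabilityMeasure.tendsto_iff_forall_integral_tendsto.2 fun f => ?_
    change Tendsto (fun i => ∫ x, f x ∂((μ i).map (X i))) l (𝓝 (∫ x, f x ∂(ν.map id)))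
    simp only [hq, Measure.map_id, hν]
    exact ((continuous_gaussianReal_var f).tendsto v).comp hv

end Convergence

/-! ### Cells of side `ε`: integrals as lattice sums -/

section Cells

variable {d : ℕ}

/-- The index of the cell of side `ε` that contains `x`. -/
def site (ε : ℝ) (x : Space d) : Fin d → ℤ := nearestSite (ε⁻¹ • x)

/-- The point of the lattice `ε ℤ^d` with index `a`. -/
def latticePoint (ε : ℝ) (a : Fin d → ℤ) : Space d := ε • WithLp.toLp 2 fun i => (a i : ℝ)

theorem site_apply (ε : ℝ) (x : Space d) (i : Fin d) : site ε x i = ⌈ε⁻¹ * x i - 1 / 2⌉ := rfl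

theorem latticePoint_apply (ε : ℝ) (a : Fin d → ℤ) (i : Fin d) :
    latticePoint ε a i = ε * a i := rfl

theorem latticePoint_shift (ε : ℝ) (a : Fin d → ℤ) (i : Fin d) :
    latticePoint ε (shift a i) = latticePoint ε a + ε • stdVec i := by
  ext k
  by_cases h : k = i
  · subst h; simp [latticePoint_apply, shift, stdVec]; ring
  · simp [latticePoint_apply, shift, stdVec, h]

theorem measurable_site (ε : ℝ) : Measurable (site ε : Space d → Fin d → ℤ) := by
  refine measurable_pi_lambda _ fun i => ?_
  simp only [site_apply]
  fun_prop

/-- Rounding ties downward makes the cells half-open cubes that tile space exactly. -/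
theorem site_eq_iff {ε : ℝ} (hε : 0 < ε) (x : Space d) (a : Fin d → ℤ) :
    site ε x = a ↔ ∀ i, x i ∈ Set.Ioc (ε * (a i - 1 / 2)) (ε * (a i + 1 / 2)) := by
  rw [funext_iff]
  refine forall_congr' fun i => ?_
  have hx : x i = ε * (ε⁻¹ * x i) := by field_simp
  rw [site_apply, Int.ceil_eq_iff, Set.mem_Ioc]
  conv_rhs => rw [hx, mul_lt_mul_iff_of_pos_left hε, mul_le_mul_iff_of_pos_left hε]
  constructor <;> rintro ⟨h1, h2⟩ <;> constructor <;> linarith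

theorem volume_site_preimage {ε : ℝ} (hε : 0 < ε) (a : Fin d → ℤ) :
    volume (site ε ⁻¹' {a} : Set (Space d)) = ENNReal.ofReal (ε ^ d) := by
  have h : (site ε ⁻¹' {a} : Set (Space d)) = (MeasurableEquiv.toLp 2 (Fin d → ℝ)).symm ⁻¹'
      (Set.univ.pi fun i => Set.Ioc (ε * (a i - 1 / 2)) (ε * (a i + 1 / 2))) := by
    ext x
    rw [Set.mem_preimage, Set.mem_singleton_iff, site_eq_iff hε, Set.mem_preimage,
      Set.mem_univ_pi]
    rfl
  rw [h, (EuclideanSpace.volume_preserving_symm_measurableEquiv_toLp (Fin d)).measure_preimage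
    (MeasurableSet.univ_pi fun i => measurableSet_Ioc).nullMeasurableSet, volume_pi_pi]
  have : ∀ i, ε * ((a i : ℝ) + 1 / 2) - ε * (a i - 1 / 2) = ε := fun i => by ring
  simp only [Real.volume_Ioc, this, ENNReal.ofReal_pow hε.le, Finset.prod_const,
    Finset.card_univ, Fintype.card_fin]

/-- Every cell has volume `ε ^ d`; this turns integrals of functions constant on cells into lattice
sums. -/
theorem map_site {ε : ℝ} (hε : 0 < ε) :
    (volume : Measure (Space d)).map (site ε) = ENNReal.ofReal (ε ^ d) • Measure.count := by
  refine Measure.ext_of_singleton fun a => ?_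
  rw [Measure.map_apply (measurable_site ε) (measurableSet_singleton a), volume_site_preimage hε]
  simp

theorem integrable_comp_site {E : Type*} [NormedAddCommGroup E] {ε : ℝ} (hε : 0 < ε)
    {g : (Fin d → ℤ) → E} (hg : g.support.Finite) :
    Integrable fun x : Space d => g (site ε x) := by
  have h : Integrable g ((volume : Measure (Space d)).map (site ε)) := by
    rw [map_site hε]
    refine Integrable.smul_measure ?_ ENNReal.ofReal_ne_top
    rw [integrable_count_iff]
    exact summable_of_hasFiniteSupport (hg.subset fun x hx => by simpa using hx)
  exact h.comp_measurable (measurable_site ε)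

theorem integral_comp_site {ε : ℝ} (hε : 0 < ε) {g : (Fin d → ℤ) → ℝ} (hg : g.support.Finite) :
    ∫ x : Space d, g (site ε x) = ε ^ d * ∑' a, g a := by
  have h : Integrable g Measure.count := by
    rw [integrable_count_iff]
    exact summable_of_hasFiniteSupport (hg.subset fun x hx => by simpa using hx)
  have h1 : AEStronglyMeasurable g ((volume : Measure (Space d)).map (site ε)) :=
    (measurable_of_countable g).aestronglyMeasurable
  rw [← integral_map (measurable_site ε).aemeasurable h1, map_site hε, integral_smul_measure,
    integral_countable h, ENNReal.toReal_ofReal (by positivity), smul_eq_mul]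
  simp

theorem norm_latticePoint_site_sub_le {ε : ℝ} (hε : 0 < ε) (x : Space d) :
    ‖latticePoint ε (site ε x) - x‖ ≤ ε * d := by
  rw [EuclideanSpace.norm_eq, Real.sqrt_le_left (by positivity)]
  have h : ∀ i, ‖(latticePoint ε (site ε x) - x) i‖ ^ 2 ≤ ε ^ 2 := by
    intro i
    have := (site_eq_iff hε x _).1 rfl i
    rw [Set.mem_Ioc] at this
    rw [PiLp.sub_apply, latticePoint_apply, Real.norm_eq_abs, sq_abs]
    nlinarith
  calc ∑ i, ‖(latticePoint ε (site ε x) - x) i‖ ^ 2 ≤ ∑ i : Fin d, ε ^ 2 :=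
        Finset.sum_le_sum fun i _ => h i
    _ = d * ε ^ 2 := by simp
    _ ≤ (ε * d) ^ 2 := by
        rw [mul_pow, mul_comm]
        gcongr
        exact_mod_cast Nat.le_self_pow two_ne_zero d

end Cells

/-! ### Summation by parts away from the boundary -/

section SummationByParts

variable {d : ℕ} {V : Type*} [NormedAddCommGroup V]

/-- The curl of a field on all edges of `ℤ^d`. -/
def latticeCurl (u : (Fin d → ℤ) → Fin d → V) (a : Fin d → ℤ) (i j : Fin d) : V :=
  u (shift a i) j - u a j - (u (shift a j) i - u a i)

/-- The adjoint of the curl applied to the curl. -/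
def curlCurl (u : (Fin d → ℤ) → Fin d → V) (a : Fin d → ℤ) (j : Fin d) : V :=
  ∑ i, (latticeCurl u (a - Pi.single i 1) i j - latticeCurl u a i j)

theorem latticeCurl_swap (u : (Fin d → ℤ) → Fin d → V) (a : Fin d → ℤ) (i j : Fin d) :
    latticeCurl u a j i = -latticeCurl u a i j := by
  simp only [latticeCurl]; abel

theorem latticeCurl_self (u : (Fin d → ℤ) → Fin d → V) (a : Fin d → ℤ) (i : Fin d) :
    latticeCurl u a i i = 0 := by
  simp [latticeCurl]

theorem curl_eq_latticeCurl {L : ℕ} (X : edges d L → V) (a : Fin d → ℤ) (i j : Fin d) :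
    curl X (a, i, j) = latticeCurl (fun a j => extend X (a, j)) a i j := by
  simp only [curl, latticeCurl]; abel

theorem mem_box {L : ℕ} {a : Fin d → ℤ} : a ∈ box d L ↔ ∀ k, |a k| ≤ L := by
  simp [box, Fintype.mem_piFinset, abs_le]

theorem abs_shift_le (a : Fin d → ℤ) (i k : Fin d) : |shift a i k| ≤ |a k| + 1 := by
  rw [shift, Pi.add_apply]
  refine (abs_add_le _ _).trans ?_
  by_cases h : k = i
  · subst h; simp
  · simp [h]

theorem abs_le_shift (a : Fin d → ℤ) (i k : Fin d) : |a k| ≤ |shift a i k| + 1 := by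
  have : a k = shift a i k - (Pi.single i 1 : Fin d → ℤ) k := by simp [shift]
  conv_lhs => rw [this]
  refine (abs_sub _ _).trans ?_
  by_cases h : k = i
  · subst h; simp
  · simp [h]

theorem extend_eq_zero {L : ℕ} (X : edges d L → V) {a : Fin d → ℤ} (ha : a ∉ box d L)
    (j : Fin d) : extend X (a, j) = 0 := by
  refine dif_neg fun h => ha ?_
  simp only [edges, Finset.mem_filter, Finset.mem_product] at h
  exact h.1.1

theorem finite_support_of_box {E : Type*} [Zero E] {L : ℕ} {g : (Fin d → ℤ) → E}
    (hg : ∀ a ∉ box d L, g a = 0) : g.support.Finite :=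
  (box d L).finite_toSet.subset fun a ha => by
    by_contra h
    exact ha (hg a h)

theorem sum_edges {L : ℕ} {g : (Fin d → ℤ) → Fin d → ℝ}
    (hg : ∀ a j, (a, j) ∉ edges d L → g a j = 0) :
    ∑ e : edges d L, g e.1.1 e.1.2 = ∑ j, ∑' a, g a j := by
  rw [Finset.sum_coe_sort (edges d L) fun e => g e.1 e.2]
  rw [Finset.sum_subset (s₁ := edges d L) (s₂ := box d L ×ˢ Finset.univ) (Finset.filter_subset _ _)
    fun e _ he => hg _ _ he, Finset.sum_product_right]
  refine Finset.sum_congr rfl fun j _ => (tsum_eq_sum fun a ha => hg a j fun h => ha ?_).symm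
  simp only [edges, Finset.mem_filter, Finset.mem_product] at h
  exact h.1.1

/-- Converts a sum over plaquettes, which have `i < j`, into one over all pairs of directions. -/
theorem sum_lt_add_swap (φ : Fin d → Fin d → ℝ) (h : ∀ i, φ i i = 0) :
    ∑ i, ∑ j, (if i < j then φ i j + φ j i else 0) = ∑ i, ∑ j, φ i j := by
  have h1 : ∀ i j, φ i j = (if i < j then φ i j else 0) + (if j < i then φ i j else 0) := by
    intro i j
    rcases lt_trichotomy i j with hij | hij | hij
    · simp [hij, hij.not_gt]
    · subst hij; simp [h]
    · simp [hij, hij.not_gt]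
  have h2 : ∀ i j, (if i < j then φ i j + φ j i else 0) =
      (if i < j then φ i j else 0) + (if i < j then φ j i else 0) := by
    intro i j; split_ifs <;> simp
  simp_rw [h2, Finset.sum_add_distrib]
  rw [Finset.sum_comm (f := fun i j => if i < j then φ j i else 0)]
  simp_rw [← Finset.sum_add_distrib]
  exact Finset.sum_congr rfl fun i _ => Finset.sum_congr rfl fun j _ => (h1 i j).symm

theorem finite_support_extend {L : ℕ} (X : edges d L → V) (j : Fin d) :
    (fun a => extend X (a, j)).support.Finite :=
  finite_support_of_box (L := L) fun _ ha => extend_eq_zero X ha j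

/-- The restriction to `Q_L` of a field on all edges. -/
def restrictBox (L : ℕ) (u : (Fin d → ℤ) → Fin d → V) : edges d L → V := fun e => u e.1.1 e.1.2

theorem extend_restrictBox {L : ℕ} {u : (Fin d → ℤ) → Fin d → V}
    (hu : ∀ a j, u a j ≠ 0 → ∀ k, |a k| + 1 ≤ L) (a : Fin d → ℤ) (j : Fin d) :
    extend (restrictBox L u) (a, j) = u a j := by
  unfold extend
  split_ifs with h
  · rfl
  · by_contra h0
    refine h ?_
    have h1 := hu a j fun h2 => h0 h2.symm
    simp only [edges, Finset.mem_filter, Finset.mem_product, Finset.mem_univ, and_true, mem_box]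
    exact ⟨fun k => by linarith [h1 k], fun k => (abs_shift_le a j k).trans (h1 k)⟩

variable [InnerProductSpace ℝ V]

/-- Discrete integration by parts: translate the index in the shifted half of the sum. -/
theorem tsum_inner_shift_sub {L : ℕ} {c h : (Fin d → ℤ) → V} (hc : ∀ a ∉ box d L, c a = 0)
    (i : Fin d) (hh : h.support.Finite) :
    ∑' a, inner ℝ (c a) (h (shift a i) - h a) =
      ∑' a, inner ℝ (c (a - Pi.single i 1) - c a) (h a) := by
  have hs : ∀ k : (Fin d → ℤ) → V, Summable fun a => (inner ℝ (c a) (k a) : ℝ) := fun k =>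
    summable_of_hasFiniteSupport (finite_support_of_box (L := L) fun a ha => by simp [hc a ha])
  have hs' : ∀ k : (Fin d → ℤ) → V, Summable fun a => (inner ℝ (k a) (h a) : ℝ) := fun k =>
    summable_of_hasFiniteSupport (hh.subset fun a ha => by
      intro h0
      exact ha (by simp [h0]))
  simp_rw [inner_sub_right, inner_sub_left]
  rw [(hs _).tsum_sub (hs _), (hs' _).tsum_sub (hs' _)]
  congr 1
  rw [← (Equiv.subRight (Pi.single i 1 : Fin d → ℤ)).tsum_eq]
  simp [shift]

/-- Here the free boundary disappears. Only `u` has to stay away from the boundary; `w` is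
arbitrary. Of the margin `3`, one step is lost to the support of the curl and two to the opposite
corner of a plaquette, so every plaquette on which the curl of `u` is nonzero lies in the box. -/
theorem actionForm_restrictBox {L : ℕ} {u : (Fin d → ℤ) → Fin d → V}
    (hu : ∀ a j, u a j ≠ 0 → ∀ k, |a k| + 3 ≤ L) (m : ℝ) (w : edges d L → V) :
    actionForm d L V m (restrictBox L u) w =
      ∑ j, ∑' a, inner ℝ (curlCurl u a j + m • u a j) (extend w (a, j)) := by
  have hext := extend_restrictBox (L := L) (u := u) fun a j h k => by linarith [hu a j h k]
  have hcurl : ∀ a i j, latticeCurl u a i j ≠ 0 → ∀ k, |a k| + 2 ≤ L := by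
    intro a i j h k
    by_contra hk
    have h0 : ∀ b l, |a k| ≤ |b k| + 1 → u b l = 0 := by
      intro b l hb
      by_contra h1
      linarith [hu b l h1 k]
    refine h ?_
    rw [latticeCurl, h0 _ _ (abs_le_shift a i k), h0 _ _ (abs_le_shift a j k),
      h0 a _ (by linarith), h0 a _ (by linarith)]
    simp
  have hcbox : ∀ i j, ∀ a ∉ box d L, latticeCurl u a i j = 0 := by
    intro i j a ha
    by_contra h
    exact ha (mem_box.2 fun k => by linarith [hcurl a i j h k])
  set W : (Fin d → ℤ) → Fin d → V := fun a j => extend w (a, j) with hW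
  -- By antisymmetry of the curl of `u`, the inner product of the two curls is `φ a i j + φ a j i`;
  -- each half has a single difference of `W`, ready for summation by parts.
  let φ : (Fin d → ℤ) → Fin d → Fin d → ℝ := fun a i j =>
    inner ℝ (latticeCurl u a i j) (W (shift a i) j - W a j)
  have hplaq : ∑ p ∈ plaquettes d L, (inner ℝ (curl (restrictBox L u) p) (curl w p) : ℝ) =
      ∑ a ∈ box d L, ∑ i, ∑ j, φ a i j := by
    have h1 : ∀ p : (Fin d → ℤ) × Fin d × Fin d,
        (inner ℝ (curl (restrictBox L u) p) (curl w p) : ℝ) =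
          φ p.1 p.2.1 p.2.2 + φ p.1 p.2.2 p.2.1 := by
      rintro ⟨a, i, j⟩
      rw [curl_eq_latticeCurl, curl_eq_latticeCurl]
      simp_rw [hext]
      simp only [φ]
      rw [latticeCurl_swap u a i j, inner_neg_left, ← sub_eq_add_neg, ← inner_sub_right]
      rfl
    simp_rw [h1]
    rw [plaquettes, Finset.sum_filter, Finset.sum_product]
    refine Finset.sum_congr rfl fun a _ => ?_
    rw [← sum_lt_add_swap (φ a) fun i => by simp [φ, latticeCurl_self], Finset.sum_product]
    refine Finset.sum_congr rfl fun i _ => Finset.sum_congr rfl fun j _ => ?_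
    by_cases hij : i < j
    · by_cases h : latticeCurl u a i j = 0
      · have h' : latticeCurl u a j i = 0 := by rw [latticeCurl_swap, h, neg_zero]
        simp [φ, h, h']
      · have h2 := hcurl a i j h
        rw [if_pos hij, if_pos]
        simp only [mem_box]
        refine ⟨hij, fun k => ?_, fun k => ?_, fun k => ?_⟩
        · linarith [abs_shift_le a i k, h2 k]
        · linarith [abs_shift_le a j k, h2 k]
        · linarith [abs_shift_le (shift a i) j k, abs_shift_le a i k, h2 k]
    · simp [hij]
  have hmass : ∑ e, (inner ℝ (restrictBox L u e) (w e) : ℝ) =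
      ∑ j, ∑' a, (inner ℝ (u a j) (W a j) : ℝ) := by
    rw [← sum_edges (L := L) (g := fun a j => inner ℝ (u a j) (W a j))]
    · refine Finset.sum_congr rfl fun e _ => ?_
      simp [restrictBox, hW, extend]
    · intro a j h
      simp [hW, extend, h]
  have hs : ∀ (k : (Fin d → ℤ) → V) (j : Fin d), Summable fun a => (inner ℝ (k a) (W a j) : ℝ) :=
    fun k j => summable_of_hasFiniteSupport ((finite_support_extend w j).subset fun a ha => by
      intro h0
      exact ha (by simp [hW, h0]))
  have hparts : ∑ a ∈ box d L, ∑ i, ∑ j, φ a i j =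
      ∑ j, ∑' a, (inner ℝ (curlCurl u a j) (W a j) : ℝ) := by
    calc ∑ a ∈ box d L, ∑ i, ∑ j, φ a i j = ∑ j, ∑ i, ∑ a ∈ box d L, φ a i j := by
          rw [Finset.sum_comm]
          simp_rw [Finset.sum_comm (s := box d L)]
          rw [Finset.sum_comm]
      _ = ∑ j, ∑ i, ∑' a, φ a i j := by
          refine Finset.sum_congr rfl fun j _ => Finset.sum_congr rfl fun i _ =>
            (tsum_eq_sum fun a ha => ?_).symm
          simp [φ, hcbox i j a ha]
      _ = ∑ j, ∑ i, ∑' a, (inner ℝ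
            (latticeCurl u (a - Pi.single i 1) i j - latticeCurl u a i j) (W a j) : ℝ) := by
          refine Finset.sum_congr rfl fun j _ => Finset.sum_congr rfl fun i _ => ?_
          exact tsum_inner_shift_sub (c := fun a => latticeCurl u a i j) (h := fun a => W a j)
            (hcbox i j) i (finite_support_extend w j)
      _ = _ := by
          refine Finset.sum_congr rfl fun j _ => ?_
          rw [← Summable.tsum_finsetSum fun i _ => hs _ j]
          simp_rw [curlCurl, sum_inner]
  rw [actionForm_apply, hplaq, hmass, hparts, Finset.mul_sum, ← Finset.sum_add_distrib]
  refine Finset.sum_congr rfl fun j _ => ?_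
  rw [← tsum_mul_left, ← (hs _ j).tsum_add ((hs _ j).mul_left m)]
  simp_rw [inner_add_left, real_inner_smul_left]
  rfl

end SummationByParts

/-! ### Cauchy-Schwarz and the triangle inequality in `L²` -/

section L2

variable {d : ℕ} {V : Type*} [NormedAddCommGroup V]

/-- The `L²` norm of a function, as a real number. -/
def l2norm {α : Type*} [MeasurableSpace α] (μ : Measure α) (f : α → V) : ℝ := √(∫ x, ‖f x‖ ^ 2 ∂μ)

theorem l2norm_nonneg {α : Type*} [MeasurableSpace α] (μ : Measure α) (f : α → V) :
    0 ≤ l2norm μ f := Real.sqrt_nonneg _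

theorem memLp_comp_site {ε : ℝ} (hε : 0 < ε) {g : (Fin d → ℤ) → V} (hg : g.support.Finite) :
    MemLp (fun x : Space d => g (site ε x)) 2 volume := by
  have h := integrable_comp_site hε hg
  rw [memLp_two_iff_integrable_sq_norm h.1]
  exact integrable_comp_site hε (g := fun a => ‖g a‖ ^ 2)
    (hg.subset fun a ha h0 => ha (by simp [h0]))

variable [InnerProductSpace ℝ V]

theorem abs_integral_inner_le {α : Type*} [MeasurableSpace α] {μ : Measure α} {f g : α → V}
    (hf : MemLp f 2 μ) (hg : MemLp g 2 μ) :
    |∫ x, inner ℝ (f x) (g x) ∂μ| ≤ l2norm μ f * l2norm μ g := by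
  have h2 : ENNReal.ofReal 2 = 2 := by norm_num
  have h := integral_mul_le_Lp_mul_Lq_of_nonneg Real.HolderConjugate.two_two (μ := μ)
    (f := fun x => ‖f x‖) (g := fun x => ‖g x‖) (Eventually.of_forall fun _ => norm_nonneg _)
    (Eventually.of_forall fun _ => norm_nonneg _) (by rw [h2]; exact hf.norm)
    (by rw [h2]; exact hg.norm)
  simp only [Real.rpow_ofNat, ← Real.sqrt_eq_rpow] at h
  refine le_trans ?_ h
  refine (norm_integral_le_integral_norm fun x => (inner ℝ (f x) (g x) : ℝ)).trans ?_
  refine integral_mono_of_nonneg (Eventually.of_forall fun _ => norm_nonneg _) ?_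
    (Eventually.of_forall fun x => norm_inner_le_norm _ _)
  exact hf.norm.integrable_mul hg.norm

theorem integrable_inner_of_memLp {α : Type*} [MeasurableSpace α] {μ : Measure α} {f g : α → V}
    (hf : MemLp f 2 μ) (hg : MemLp g 2 μ) : Integrable (fun x => (inner ℝ (f x) (g x) : ℝ)) μ :=
  (hf.norm.integrable_mul hg.norm).mono' (hf.1.inner hg.1)
    (Eventually.of_forall fun _ => norm_inner_le_norm _ _)

theorem l2norm_add_le {α : Type*} [MeasurableSpace α] {μ : Measure α} {f g : α → V}
    (hf : MemLp f 2 μ) (hg : MemLp g 2 μ) :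
    l2norm μ (fun x => f x + g x) ≤ l2norm μ f + l2norm μ g := by
  have e : ∀ h : α → V, MemLp h 2 μ → l2norm μ h ^ 2 = ∫ x, ‖h x‖ ^ 2 ∂μ := fun h _ =>
    Real.sq_sqrt (integral_nonneg fun _ => by positivity)
  refine abs_le_of_sq_le_sq' ?_ (add_nonneg (l2norm_nonneg _ _) (l2norm_nonneg _ _)) |>.2
  rw [e (fun x => f x + g x) (hf.add hg), add_sq, e f hf, e g hg]
  have i1 := (memLp_two_iff_integrable_sq_norm hf.1).1 hf
  have i2 := (memLp_two_iff_integrable_sq_norm hg.1).1 hg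
  have i3 := integrable_inner_of_memLp hf hg
  simp_rw [norm_add_sq_real]
  rw [integral_add (f := fun x => ‖f x‖ ^ 2 + 2 * inner ℝ (f x) (g x))
    (i1.add (i3.const_mul 2)) i2, integral_add i1 (i3.const_mul 2), integral_const_mul]
  have := (le_abs_self _).trans (abs_integral_inner_le hf hg)
  linarith

end L2

/-! ### Scaling of the field and of its pairing with a test form -/

section Rescaled

variable {d L : ℕ} {V : Type*} [NormedAddCommGroup V] [InnerProductSpace ℝ V]

theorem rescaledForm_apply (ε β : ℝ) (X : edges d L → V) (j : Fin d) (x : Space d) :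
    rescaledForm ε β X j x =
      ε ^ (-((d : ℝ) - 2) / 2) • √β • extend X (site ε x, j) := rfl

/-- The square of the field normalisation times the volume of a cell. The remaining `ε ^ 2` is the
factor in the lattice mass `ε ^ 2 * m`. -/
theorem rpow_scaling {ε : ℝ} (hε : 0 < ε) :
    (ε ^ (-((d : ℝ) - 2) / 2)) ^ 2 * ε ^ d = ε ^ 2 := by
  rw [← Real.rpow_natCast _ 2, ← Real.rpow_mul hε.le, ← Real.rpow_natCast ε d,
    ← Real.rpow_add hε, ← Real.rpow_natCast ε 2]
  congr 1
  push_cast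
  ring

theorem memLp_rescaledForm {ε : ℝ} (hε : 0 < ε) (β : ℝ) (X : edges d L → V) (j : Fin d) :
    MemLp (rescaledForm ε β X j) 2 volume :=
  memLp_comp_site hε (g := fun a => ε ^ (-((d : ℝ) - 2) / 2) • √β • extend X (a, j))
    ((finite_support_extend X j).subset fun a ha h0 => ha (by
      simp only at h0; simp [h0]))

theorem l2norm_rescaledForm_le {ε : ℝ} (hε : 0 < ε) (X : edges d L → V) (j : Fin d) :
    l2norm volume (rescaledForm ε 1 X j) ≤ ε * √(∑ e, ‖X e‖ ^ 2) := by
  have hfin : ∀ j, (fun a => ‖extend X (a, j)‖ ^ 2).support.Finite := fun j =>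
    (finite_support_extend X j).subset fun a ha h0 => ha (by simp only at h0; simp [h0])
  have h1 : ∫ x, ‖rescaledForm ε 1 X j x‖ ^ 2 = ε ^ 2 * ∑' a, ‖extend X (a, j)‖ ^ 2 := by
    simp_rw [rescaledForm_apply, norm_smul, mul_pow, Real.sqrt_one, norm_one, one_pow, one_mul,
      Real.norm_eq_abs, sq_abs]
    rw [integral_const_mul, integral_comp_site hε (g := fun a => ‖extend X (a, j)‖ ^ 2) (hfin j),
      ← mul_assoc, rpow_scaling hε]
  have h2 : ∑' a, ‖extend X (a, j)‖ ^ 2 ≤ ∑ e, ‖X e‖ ^ 2 := by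
    have h3 : ∑ e, ‖X e‖ ^ 2 = ∑ j, ∑' a, ‖extend X (a, j)‖ ^ 2 := by
      rw [← sum_edges (L := L) (g := fun a j => ‖extend X (a, j)‖ ^ 2)]
      · exact Finset.sum_congr rfl fun e _ => by simp [extend]
      · intro a j h; simp [extend, h]
    rw [h3]
    exact Finset.single_le_sum (f := fun j => ∑' a, ‖extend X (a, j)‖ ^ 2)
      (fun j _ => tsum_nonneg fun a => by positivity) (Finset.mem_univ j)
  rw [l2norm, h1, Real.sqrt_mul (by positivity), Real.sqrt_sq hε.le]
  gcongr

theorem TestForm.memLp (F : TestForm d V) (j : Fin d) : MemLp (F.toFun j) 2 volume :=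
  (F.smooth j).continuous.memLp_of_hasCompactSupport (F.compactSupport j)

/-- The pairing with `F` at unit inverse coupling, as a linear functional. -/
def pairingLin (L : ℕ) {ε : ℝ} (hε : 0 < ε) (F : TestForm d V) : (edges d L → V) →ₗ[ℝ] ℝ where
  toFun X := rescaledPairing ε 1 F X
  map_add' X Y := by
    simp only [rescaledPairing, ← Finset.sum_add_distrib]
    refine Finset.sum_congr rfl fun j _ => ?_
    rw [← integral_add (integrable_inner_of_memLp (memLp_rescaledForm hε 1 X j) (F.memLp j))
      (integrable_inner_of_memLp (memLp_rescaledForm hε 1 Y j) (F.memLp j))]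
    simp only [rescaledForm_apply, extend_add, smul_add, inner_add_left]
  map_smul' c X := by
    simp only [rescaledPairing, Finset.mul_sum, RingHom.id_apply, smul_eq_mul]
    refine Finset.sum_congr rfl fun j _ => ?_
    rw [← integral_const_mul]
    simp only [rescaledForm_apply, extend_smul, ← real_inner_smul_left]
    simp only [smul_comm c]

theorem pairingLin_apply {ε : ℝ} (hε : 0 < ε) (F : TestForm d V) (X : edges d L → V) :
    pairingLin L hε F X = ∑ j, ∫ x, inner ℝ (rescaledForm ε 1 X j x) (F.toFun j x) := rfl

theorem rescaledPairing_eq {ε : ℝ} (hε : 0 < ε) (β : ℝ) (F : TestForm d V) (X : edges d L → V) :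
    rescaledPairing ε β F X = (√β • pairingLin L hε F) X := by
  rw [LinearMap.smul_apply, pairingLin_apply, rescaledPairing, smul_eq_mul, Finset.mul_sum]
  refine Finset.sum_congr rfl fun j _ => ?_
  rw [← integral_const_mul]
  simp only [rescaledForm_apply, ← real_inner_smul_left, Real.sqrt_one, one_smul, smul_comm √β]

theorem abs_sum_integral_rescaledForm_le {ε : ℝ} (hε : 0 < ε) (X : edges d L → V)
    {H : Fin d → Space d → V} (hH : ∀ j, MemLp (H j) 2 volume) :
    |∑ j, ∫ x, inner ℝ (rescaledForm ε 1 X j x) (H j x)| ≤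
      ε * √(∑ e, ‖X e‖ ^ 2) * ∑ j, l2norm volume (H j) := by
  rw [Finset.mul_sum]
  refine (Finset.abs_sum_le_sum_abs _ _).trans (Finset.sum_le_sum fun j _ => ?_)
  refine (abs_integral_inner_le (memLp_rescaledForm hε 1 X j) (hH j)).trans ?_
  exact mul_le_mul_of_nonneg_right (l2norm_rescaledForm_le hε X j) (l2norm_nonneg _ _)

end Rescaled

/-! ### The discretised equation and the energy estimate -/

section Consistency

variable {d : ℕ} {V : Type*} [NormedAddCommGroup V] [InnerProductSpace ℝ V]

/-- The curl of the form `U` at lattice spacing `ε`, without the factor `ε⁻¹`. -/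
def diffCurl (ε : ℝ) (U : Fin d → Space d → V) (x : Space d) (i j : Fin d) : V :=
  U j (x + ε • stdVec i) - U j x - (U i (x + ε • stdVec j) - U i x)

/-- The finite difference approximation at lattice spacing `ε` of the operator `d* d + m`. -/
def procaDiff (ε m : ℝ) (U : Fin d → Space d → V) (j : Fin d) (x : Space d) : V :=
  (ε ^ 2)⁻¹ • ∑ i, (diffCurl ε U (x - ε • stdVec i) i j - diffCurl ε U x i j) + m • U j x

theorem latticePoint_sub_single (ε : ℝ) (a : Fin d → ℤ) (i : Fin d) :
    latticePoint ε (a - Pi.single i 1) = latticePoint ε a - ε • stdVec i := by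
  have h := latticePoint_shift ε (a - Pi.single i 1) i
  rw [show shift (a - Pi.single i 1) i = a by simp [shift]] at h
  rw [h, add_sub_cancel_right]

theorem norm_stdVec (i : Fin d) : ‖stdVec i‖ = 1 := by simp [stdVec]

/-- The stencil consists of two nested differences, so it reaches at most `2 * ε` from `x`. -/
theorem procaDiff_eq_zero {ε R : ℝ} (hε : 0 < ε) (m : ℝ) {U : Fin d → Space d → V}
    (hU : ∀ j x, R < ‖x‖ → U j x = 0) (j : Fin d) {x : Space d} (hx : R + 2 * ε < ‖x‖) :
    procaDiff ε m U j x = 0 := by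
  have hn : ∀ i : Fin d, ‖ε • stdVec i‖ = ε := fun i => by
    rw [norm_smul, norm_stdVec, mul_one, Real.norm_of_nonneg hε.le]
  have hc : ∀ (y : Space d) i j, R + ε < ‖y‖ → diffCurl ε U y i j = 0 := by
    intro y i j hy
    have h1 : ∀ i, R < ‖y + ε • stdVec i‖ := fun i => by
      have := norm_sub_le (y + ε • stdVec i) (ε • stdVec i)
      rw [add_sub_cancel_right, hn] at this
      linarith
    rw [diffCurl, hU _ _ (h1 i), hU _ _ (h1 j), hU _ y (by linarith), hU _ y (by linarith)]
    simp
  rw [procaDiff, hU j x (by linarith), Finset.sum_eq_zero]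
  · simp
  intro i _
  rw [hc x i j (by linarith), hc _ i j, sub_zero]
  have := norm_add_le (x - ε • stdVec i) (ε • stdVec i)
  rw [sub_add_cancel, hn] at this
  linarith

theorem abs_le_of_norm_latticePoint_le {ε R : ℝ} (hε : 0 < ε) {a : Fin d → ℤ}
    (h : ‖latticePoint ε a‖ ≤ R) (k : Fin d) : |(a k : ℝ)| ≤ R / ε := by
  rw [le_div_iff₀ hε]
  have h1 := (PiLp.norm_apply_le (latticePoint ε a) k).trans h
  rw [latticePoint_apply, norm_mul, Real.norm_of_nonneg hε.le] at h1
  rw [mul_comm]; exact h1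

theorem finite_support_of_latticePoint {E : Type*} [Zero E] {ε R : ℝ} (hε : 0 < ε)
    {g : Space d → E} (hg : ∀ x, R < ‖x‖ → g x = 0) :
    (fun a => g (latticePoint ε a)).support.Finite := by
  refine finite_support_of_box (L := ⌈R / ε⌉₊) fun a ha => hg _ ?_
  by_contra h
  refine ha (mem_box.2 fun k => ?_)
  have := (abs_le_of_norm_latticePoint_le hε (not_lt.1 h) k).trans (Nat.le_ceil _)
  exact_mod_cast this

/-- The lattice field that approximates the form `U`. -/
def discretize (ε : ℝ) (U : Fin d → Space d → V) (a : Fin d → ℤ) (j : Fin d) : V :=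
  (ε ^ (-((d : ℝ) - 2) / 2))⁻¹ • U j (latticePoint ε a)

theorem curlCurl_discretize {ε : ℝ} (hε : 0 < ε) (m : ℝ) (U : Fin d → Space d → V)
    (a : Fin d → ℤ) (j : Fin d) :
    curlCurl (discretize ε U) a j + (ε ^ 2 * m) • discretize ε U a j =
      (ε ^ (-((d : ℝ) - 2) / 2))⁻¹ • ε ^ 2 • procaDiff ε m U j (latticePoint ε a) := by
  have h1 : ∀ (a : Fin d → ℤ) (i : Fin d), latticeCurl (discretize ε U) a i j =
      (ε ^ (-((d : ℝ) - 2) / 2))⁻¹ • diffCurl ε U (latticePoint ε a) i j := by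
    intro a i
    simp only [latticeCurl, discretize, latticePoint_shift, diffCurl, smul_sub]
  simp only [curlCurl, h1, latticePoint_sub_single, procaDiff, discretize, smul_add,
    ← smul_sub, ← Finset.smul_sum]
  congr 1
  · rw [smul_smul (ε ^ 2), mul_inv_cancel₀ (by positivity), one_smul]
  · simp only [smul_smul]; congr 1; ring

theorem extend_discretize {L : ℕ} {ε R : ℝ} (hε : 0 < ε) {U : Fin d → Space d → V}
    (hU : ∀ j x, R < ‖x‖ → U j x = 0) (hL : R / ε + 3 ≤ L) (a : Fin d → ℤ) (j : Fin d)
    (h : discretize ε U a j ≠ 0) (k : Fin d) : |a k| + 3 ≤ L := by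
  have h1 : ‖latticePoint ε a‖ ≤ R := by
    by_contra h2
    exact h (by rw [discretize, hU j _ (not_le.1 h2), smul_zero])
  have := abs_le_of_norm_latticePoint_le hε h1 k
  have : (|(a k : ℝ)| + 3) ≤ L := by linarith
  exact_mod_cast this

/-- The weak form of the difference equation, with no error term: on a sampled form the action form
is an `L²` pairing, just like the right-hand side `pairingLin`. Hence the two can be subtracted
under one integral. -/
theorem actionForm_discretize {L : ℕ} {ε R : ℝ} (hε : 0 < ε) (m : ℝ) {U : Fin d → Space d → V}
    (hU : ∀ j x, R < ‖x‖ → U j x = 0) (hL : R / ε + 3 ≤ L) (w : edges d L → V) :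
    actionForm d L V (ε ^ 2 * m) (restrictBox L (discretize ε U)) w =
      ∑ j, ∫ x, inner ℝ (rescaledForm ε 1 w j x)
        (procaDiff ε m U j (latticePoint ε (site ε x))) := by
  have hs : 0 < ε ^ (-((d : ℝ) - 2) / 2) := Real.rpow_pos_of_pos hε _
  rw [actionForm_restrictBox (extend_discretize hε hU hL)]
  refine Finset.sum_congr rfl fun j _ => ?_
  simp_rw [curlCurl_discretize hε, rescaledForm_apply, real_inner_smul_left, Real.sqrt_one,
    one_mul]
  rw [integral_const_mul, integral_comp_site hε (g := fun a => inner ℝ (extend w (a, j))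
    (procaDiff ε m U j (latticePoint ε a))), tsum_mul_left, tsum_mul_left, ← mul_assoc,
    ← mul_assoc]
  · simp_rw [real_inner_comm]
    congr 1
    -- With `s` the field normalisation, the factors agree because `s² ε^d = ε²`, that is, `s⁻¹ ε² =
    -- s ε^d`.
    have h := rpow_scaling (d := d) hε
    generalize ε ^ (-((d : ℝ) - 2) / 2) = s at hs h
    field_simp
    linarith
  · exact (finite_support_extend w j).subset fun a ha h0 => ha (by simp only at h0; simp [h0])

theorem pairingLin_discretize {L : ℕ} {ε R : ℝ} (hε : 0 < ε) {U : Fin d → Space d → V}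
    (hU : ∀ j x, R < ‖x‖ → U j x = 0) (hL : R / ε + 3 ≤ L) (F : TestForm d V) :
    pairingLin L hε F (restrictBox L (discretize ε U)) =
      ∑ j, ∫ x, inner ℝ (U j (latticePoint ε (site ε x))) (F.toFun j x) := by
  have hs : 0 < ε ^ (-((d : ℝ) - 2) / 2) := Real.rpow_pos_of_pos hε _
  rw [pairingLin_apply]
  refine Finset.sum_congr rfl fun j _ => ?_
  simp_rw [rescaledForm_apply]
  simp_rw [extend_restrictBox fun a j h k => by linarith [extend_discretize hε hU hL a j h k],
    discretize, Real.sqrt_one, one_smul, smul_inv_smul₀ hs.ne']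

/-- The variance of the pairing is close to its value on an approximate solution of the
continuum equation. -/
theorem abs_pairingLin_sub_le {L : ℕ} {ε R m : ℝ} (hε : 0 < ε) (hm : 0 < m)
    {U : Fin d → Space d → V} (hU : ∀ j x, R < ‖x‖ → U j x = 0) (hL : R / ε + 3 ≤ L)
    (F : TestForm d V) {Y : edges d L → V}
    (hY : actionForm d L V (ε ^ 2 * m) Y = pairingLin L hε F) :
    |pairingLin L hε F Y - ∑ j, ∫ x, inner ℝ (U j (latticePoint ε (site ε x))) (F.toFun j x)| ≤
      m⁻¹ * (∑ j, l2norm volume (F.toFun j)) * ∑ j, l2norm volume fun x =>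
        F.toFun j x - procaDiff ε m U j (latticePoint ε (site ε x)) := by
  set u := restrictBox L (discretize ε U)
  set K := ∑ j, l2norm volume fun x =>
        F.toFun j x - procaDiff ε m U j (latticePoint ε (site ε x))
  set Z := Y - u
  set n := √(∑ e, ‖Z e‖ ^ 2)
  have hn : 0 ≤ n := Real.sqrt_nonneg _
  have hn2 : n ^ 2 = ∑ e, ‖Z e‖ ^ 2 := Real.sq_sqrt (by positivity)
  have hK : 0 ≤ K := Finset.sum_nonneg fun _ _ => l2norm_nonneg _ _
  have hD : ∀ j, MemLp (fun x => procaDiff ε m U j (latticePoint ε (site ε x))) 2 volume :=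
    fun j => memLp_comp_site hε (g := fun a => procaDiff ε m U j (latticePoint ε a))
      (finite_support_of_latticePoint hε fun x hx => procaDiff_eq_zero hε m hU j hx)
  -- Testing the equation for `Z` with `Z` itself pairs it with the residual of `U`, and
  -- Cauchy-Schwarz applies.
  have hB : actionForm d L V (ε ^ 2 * m) Z Z ≤ ε * n * K := by
    have h1 : actionForm d L V (ε ^ 2 * m) Z Z = ∑ j, ∫ x, inner ℝ (rescaledForm ε 1 Z j x)
        (F.toFun j x - procaDiff ε m U j (latticePoint ε (site ε x))) := by
      have h2 : actionForm d L V (ε ^ 2 * m) Z Z =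
          pairingLin L hε F Z - actionForm d L V (ε ^ 2 * m) u Z := by
        conv_lhs => rw [show actionForm d L V (ε ^ 2 * m) Z =
          actionForm d L V (ε ^ 2 * m) Y - actionForm d L V (ε ^ 2 * m) u from map_sub _ _ _]
        rw [hY, LinearMap.sub_apply]
      rw [h2, actionForm_discretize hε m hU hL, pairingLin_apply, ← Finset.sum_sub_distrib]
      refine Finset.sum_congr rfl fun j _ => ?_
      simp_rw [inner_sub_right]
      rw [integral_sub (integrable_inner_of_memLp (memLp_rescaledForm hε 1 Z j) (F.memLp j))
        (integrable_inner_of_memLp (memLp_rescaledForm hε 1 Z j) (hD j))]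
    rw [h1]
    exact (le_abs_self _).trans
      (abs_sum_integral_rescaledForm_le hε Z fun j => (F.memLp j).sub (hD j))
  -- The mass term bounds the energy below by `ε² m n²`; dividing `ε² m n² ≤ ε n K` by `ε n` needs
  -- `n ≠ 0`.
  have hnK : ε * n ≤ m⁻¹ * K := by
    have h1 := (mul_sum_norm_sq_le_actionForm (ε ^ 2 * m) Z).trans hB
    rw [← hn2] at h1
    rcases hn.eq_or_lt with h0 | h0
    · rw [← h0, mul_zero]; positivity
    · rw [inv_mul_eq_div, le_div_iff₀ hm]
      have h3 : ε * n * (ε * n * m) ≤ ε * n * K := by nlinarith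
      exact le_of_mul_le_mul_left h3 (by positivity)
  rw [← pairingLin_discretize hε hU hL F, ← map_sub]
  refine (abs_sum_integral_rescaledForm_le hε Z F.memLp).trans ?_
  calc ε * n * ∑ j, l2norm volume (F.toFun j)
      ≤ m⁻¹ * K * ∑ j, l2norm volume (F.toFun j) :=
        mul_le_mul_of_nonneg_right hnK (Finset.sum_nonneg fun _ _ => l2norm_nonneg _ _)
    _ = _ := by ring

end Consistency

/-! ### Taylor estimates for Schwartz functions -/

section FiniteDifferences

variable {E V : Type*} [NormedAddCommGroup E] [NormedSpace ℝ E] [NormedAddCommGroup V]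
  [NormedSpace ℝ V]

theorem schwartz_bounded (f : 𝓢(E, V)) : ∃ K, 0 ≤ K ∧ ∀ x, ‖f x‖ ≤ K :=
  ⟨SchwartzMap.seminorm ℝ 0 0 f, apply_nonneg _ _, fun x => f.norm_le_seminorm ℝ x⟩

theorem schwartz_lipschitz (f : 𝓢(E, V)) : ∃ K, 0 ≤ K ∧ ∀ x y, ‖f y - f x‖ ≤ K * ‖y - x‖ := by
  obtain ⟨K, hK, h⟩ := schwartz_bounded (SchwartzMap.fderivCLM ℝ E V f)
  exact ⟨K, hK, fun x y => convex_univ.norm_image_sub_le_of_norm_fderiv_le (𝕜 := ℝ)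
    (fun z _ => f.differentiableAt) (fun z _ => h z) (Set.mem_univ x) (Set.mem_univ y)⟩

theorem schwartz_taylor (f : 𝓢(E, V)) :
    ∃ K, 0 ≤ K ∧ ∀ x h, ‖f (x + h) - f x - fderiv ℝ f x h‖ ≤ K * ‖h‖ ^ 2 := by
  obtain ⟨K, hK, hlip⟩ := schwartz_lipschitz (SchwartzMap.fderivCLM ℝ E V f)
  refine ⟨K, hK, fun x h => ?_⟩
  have := (convex_closedBall x ‖h‖).norm_image_sub_le_of_norm_fderiv_le' (𝕜 := ℝ) (f := f)
    (φ := fderiv ℝ f x) (C := K * ‖h‖) (y := x + h) (fun z _ => f.differentiableAt)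
    (fun z hz => (hlip x z).trans (by
      rw [mem_closedBall_iff_norm] at hz
      exact mul_le_mul_of_nonneg_left hz hK)) (Metric.mem_closedBall_self (norm_nonneg h))
    (by simp)
  rw [add_sub_cancel_left] at this
  rwa [pow_two, ← mul_assoc]

theorem lineDeriv_lineDeriv_apply (f : 𝓢(E, V)) (h k x : E) :
    (∂_{h} (∂_{k} f)) x = fderiv ℝ (SchwartzMap.fderivCLM ℝ E V f) x h k := by
  rw [SchwartzMap.lineDerivOp_apply_eq_fderiv]
  have h1 : ((∂_{k} f : 𝓢(E, V)) : E → V) = fun y => SchwartzMap.fderivCLM ℝ E V f y k := by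
    ext y; rw [SchwartzMap.lineDerivOp_apply_eq_fderiv]; rfl
  rw [h1, fderiv_clm_apply (SchwartzMap.differentiableAt _) (differentiableAt_const k)]
  simp

theorem schwartz_isSymmSndFDerivAt (f : 𝓢(E, V)) (x : E) : IsSymmSndFDerivAt ℝ f x := by
  have h : ContDiffAt ℝ 2 f x := mod_cast f.contDiffAt 2
  exact h.isSymmSndFDerivAt (by simp)

theorem lineDeriv_comm (f : 𝓢(E, V)) (h k : E) : ∂_{h} (∂_{k} f) = ∂_{k} (∂_{h} f) := by
  ext x
  rw [lineDeriv_lineDeriv_apply, lineDeriv_lineDeriv_apply]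
  exact schwartz_isSymmSndFDerivAt f x h k

/-- The first-order remainder `ψ y = f (y + k) - f y - f' y k` has as derivative the Taylor
remainder of `f'` with increment `k`, which is `O(‖k‖²)`. The mean value inequality for `ψ` along
`h`, plus the Taylor remainder of `f'` along `h`, gives the bound. -/
theorem schwartz_second_difference (f : 𝓢(E, V)) : ∃ K, 0 ≤ K ∧ ∀ x h k,
    ‖f (x + h + k) - f (x + h) - (f (x + k) - f x) - (∂_{h} (∂_{k} f)) x‖ ≤
      K * (‖h‖ * ‖k‖ * (‖h‖ + ‖k‖)) := by
  obtain ⟨K, hK, htay⟩ := schwartz_taylor (SchwartzMap.fderivCLM ℝ E V f)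
  refine ⟨K, hK, fun x h k => ?_⟩
  set Φ := SchwartzMap.fderivCLM ℝ E V f with hΦ
  let ψ : E → V := fun y => f (y + k) - f y - Φ y k
  have hd : ∀ y, HasFDerivAt ψ (Φ (y + k) - Φ y - fderiv ℝ Φ y k) y := by
    intro y
    have h1 : HasFDerivAt (fun y => f (y + k)) (Φ (y + k)) y := by
      have := (f.hasFDerivAt (y + k)).comp y ((hasFDerivAt_id y).add_const k)
      rwa [ContinuousLinearMap.comp_id] at this
    have h2 : HasFDerivAt (fun y => Φ y k) ((fderiv ℝ Φ y).flip k) y := by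
      have := (Φ.hasFDerivAt y).clm_apply (hasFDerivAt_const k y)
      simpa using this
    -- Symmetry of the second derivative makes `k` the increment, so that `htay` applies to the
    -- derivative of `ψ`.
    have h3 : (fderiv ℝ Φ y).flip k = fderiv ℝ Φ y k := by
      ext v
      rw [ContinuousLinearMap.flip_apply]
      exact schwartz_isSymmSndFDerivAt f y v k
    rw [← h3]
    exact (h1.sub (f.hasFDerivAt y)).sub h2
  have h4 : ‖ψ (x + h) - ψ x‖ ≤ K * ‖k‖ ^ 2 * ‖h‖ := by
    have := convex_univ.norm_image_sub_le_of_norm_hasFDerivWithin_le (𝕜 := ℝ) (f := ψ)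
      (C := K * ‖k‖ ^ 2) (fun y _ => (hd y).hasFDerivWithinAt) (fun y _ => htay y k)
      (Set.mem_univ x) (Set.mem_univ (x + h))
    rwa [add_sub_cancel_left] at this
  have h5 : ‖Φ (x + h) k - Φ x k - fderiv ℝ Φ x h k‖ ≤ K * ‖h‖ ^ 2 * ‖k‖ :=
    ((Φ (x + h) - Φ x - fderiv ℝ Φ x h).le_opNorm k).trans
      (mul_le_mul_of_nonneg_right (htay x h) (norm_nonneg k))
  rw [lineDeriv_lineDeriv_apply]
  calc _ = ‖(ψ (x + h) - ψ x) + (Φ (x + h) k - Φ x k - fderiv ℝ Φ x h k)‖ := by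
        congr 1; simp only [ψ]; abel
    _ ≤ _ := (norm_add_le _ _).trans (add_le_add h4 h5)
    _ = _ := by ring

end FiniteDifferences

/-! ### From uniform bounds on a fixed ball to `L²` bounds -/

section Bounds

variable {d : ℕ} {V : Type*} [NormedAddCommGroup V]

theorem l2norm_le_of_bound {R K : ℝ} (hK : 0 ≤ K) {f : Space d → V} (hf : ∀ x, ‖f x‖ ≤ K)
    (h0 : ∀ x, R < ‖x‖ → f x = 0) :
    l2norm volume f ≤ K * √(volume.real (Metric.closedBall (0 : Space d) R)) := by
  have h1 : ∫ x, ‖f x‖ ^ 2 ≤ K ^ 2 * volume.real (Metric.closedBall (0 : Space d) R) := by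
    calc ∫ x, ‖f x‖ ^ 2
        ≤ ∫ x, (Metric.closedBall (0 : Space d) R).indicator (fun _ => K ^ 2) x := by
          refine integral_mono_of_nonneg (Eventually.of_forall fun _ => by positivity)
            ((integrable_indicator_iff measurableSet_closedBall).2 (integrableOn_const
              measure_closedBall_lt_top.ne)) (Eventually.of_forall fun x => ?_)
          by_cases hx : x ∈ Metric.closedBall (0 : Space d) R
          · simp only [Set.indicator_of_mem hx]
            exact pow_le_pow_left₀ (norm_nonneg _) (hf x) 2
          · simp only [Set.indicator_of_notMem hx]
            rw [mem_closedBall_zero_iff, not_le] at hx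
            simp [h0 x hx]
      _ = _ := by
          rw [integral_indicator_const _ measurableSet_closedBall, smul_eq_mul, mul_comm]
  rw [l2norm]
  refine (Real.sqrt_le_sqrt h1).trans_eq ?_
  rw [Real.sqrt_mul (by positivity), Real.sqrt_sq hK]

theorem tendsto_l2norm_of_bound {R K : ℝ} (hK : 0 ≤ K) {f : ℝ → Space d → V}
    (hf : ∀ ε x, 0 < ε → ‖f ε x‖ ≤ K * ε) (h0 : ∀ ε x, 0 < ε → ε < 1 → R < ‖x‖ → f ε x = 0) :
    Tendsto (fun ε => l2norm volume (f ε)) (𝓝[>] 0) (𝓝 0) := by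
  have h1 : Tendsto (fun ε : ℝ => K * ε * √(volume.real (Metric.closedBall (0 : Space d) R)))
      (𝓝[>] 0) (𝓝 0) := by
    have : Tendsto (fun ε : ℝ => K * ε * √(volume.real (Metric.closedBall (0 : Space d) R)))
      (𝓝 0) (𝓝 (K * 0 * √(volume.real (Metric.closedBall (0 : Space d) R)))) :=
      (tendsto_id.const_mul K).mul_const _
    rw [mul_zero, zero_mul] at this
    exact this.mono_left nhdsWithin_le_nhds
  refine tendsto_of_tendsto_of_tendsto_of_le_of_le' tendsto_const_nhds h1
    (Eventually.of_forall fun _ => l2norm_nonneg _ _) ?_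
  filter_upwards [self_mem_nhdsWithin, mem_nhdsWithin_of_mem_nhds (gt_mem_nhds one_pos)]
    with ε hε hε1
  exact l2norm_le_of_bound (mul_nonneg hK (le_of_lt hε)) (fun x => hf ε x hε)
    fun x hx => h0 ε x hε hε1 hx

theorem memLp_comp_latticePoint {R ε : ℝ} (hε : 0 < ε) {g : Space d → V}
    (hg : ∀ x, R < ‖x‖ → g x = 0) :
    MemLp (fun x => g (latticePoint ε (site ε x))) 2 volume :=
  memLp_comp_site hε (g := fun a => g (latticePoint ε a)) (finite_support_of_latticePoint hε hg)

end Bounds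

/-! ### Consistency of the finite difference operator -/

section ContinuumOperator

variable {d : ℕ} {V : Type*} [NormedAddCommGroup V] [InnerProductSpace ℝ V]

/-- The operator `d* d + m` on Schwartz 1-forms. -/
def procaDiffOp (m : ℝ) (U : Fin d → 𝓢(Space d, V)) (j : Fin d) : 𝓢(Space d, V) :=
  ∑ i, (∂_{stdVec i} (∂_{stdVec j} (U i)) - ∂_{stdVec i} (∂_{stdVec i} (U j))) + m • U j

theorem lineDeriv_smul_left {E : Type*} [NormedAddCommGroup E] [NormedSpace ℝ E]
    (f : 𝓢(E, V)) (c : ℝ) (h : E) : ∂_{c • h} f = c • ∂_{h} f := by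
  ext x
  simp [SchwartzMap.lineDerivOp_apply_eq_fderiv]

/-- The mixed difference with increments `-ε e_i` and `ε e_j`; the negative increment accounts for
the plus sign before the derivative. -/
theorem norm_second_difference_sub_le (f : 𝓢(Space d, V)) : ∃ K, 0 ≤ K ∧
    ∀ (ε : ℝ) (x : Space d) (i j : Fin d), 0 < ε →
    ‖f (x - ε • stdVec i + ε • stdVec j) - f (x - ε • stdVec i) - (f (x + ε • stdVec j) - f x) +
      ε ^ 2 • (∂_{stdVec i} (∂_{stdVec j} f)) x‖ ≤ K * ε ^ 3 := by
  obtain ⟨K, hK, h⟩ := schwartz_second_difference f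
  refine ⟨2 * K, by positivity, fun ε x i j hε => ?_⟩
  have h1 := h x (-(ε • stdVec i)) (ε • stdVec j)
  have h2 : ∂_{-(ε • stdVec i)} (∂_{ε • stdVec j} f) =
      -(ε ^ 2 • ∂_{stdVec i} (∂_{stdVec j} f)) := by
    rw [← neg_smul, lineDeriv_smul_left, lineDeriv_smul_left, LineDeriv.lineDerivOp_smul,
      smul_smul, ← neg_smul]
    congr 1; ring
  rw [h2, norm_neg, norm_smul, norm_smul, norm_stdVec, norm_stdVec, Real.norm_of_nonneg hε.le,
    ← sub_eq_add_neg] at h1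
  rw [neg_apply, sub_neg_eq_add, smul_apply] at h1
  exact h1.trans_eq (by ring)

/-- Each second difference has error `O(ε³)`, and the operator divides it by `ε²`. The mass terms
cancel. -/
theorem norm_procaDiff_sub_le (m : ℝ) (U : Fin d → 𝓢(Space d, V)) : ∃ K, 0 ≤ K ∧
    ∀ (ε : ℝ) (j : Fin d) (x : Space d), 0 < ε →
      ‖procaDiff ε m (fun j => U j) j x - procaDiffOp m U j x‖ ≤ K * ε := by
  choose K hK h using fun i => norm_second_difference_sub_le (U i)
  have hKK : ∀ j, 0 ≤ ∑ i, (K j + K i) := fun j =>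
    Finset.sum_nonneg fun i _ => add_nonneg (hK j) (hK i)
  refine ⟨∑ j, ∑ i, (K j + K i), Finset.sum_nonneg fun j _ => hKK j, fun ε j x hε => ?_⟩
  have hsum : (ε ^ 2 : ℝ) • (procaDiff ε m (fun j => U j) j x - procaDiffOp m U j x) =
      ∑ i, ((U j (x - ε • stdVec i + ε • stdVec i) - U j (x - ε • stdVec i) -
          (U j (x + ε • stdVec i) - U j x) + ε ^ 2 • (∂_{stdVec i} (∂_{stdVec i} (U j))) x) -
        (U i (x - ε • stdVec i + ε • stdVec j) - U i (x - ε • stdVec i) -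
          (U i (x + ε • stdVec j) - U i x) + ε ^ 2 • (∂_{stdVec i} (∂_{stdVec j} (U i))) x)) := by
    rw [procaDiff, procaDiffOp, add_apply, smul_apply,
      sum_apply, add_sub_add_right_eq_sub, smul_sub, smul_smul,
      mul_inv_cancel₀ (by positivity), one_smul, Finset.smul_sum, ← Finset.sum_sub_distrib]
    refine Finset.sum_congr rfl fun i _ => ?_
    simp only [diffCurl, sub_apply, smul_sub]
    abel
  have hb : ε ^ 2 * ‖procaDiff ε m (fun j => U j) j x - procaDiffOp m U j x‖ ≤
      ε ^ 2 * ((∑ j, ∑ i, (K j + K i)) * ε) := by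
    have h0 : ε ^ 2 * ‖procaDiff ε m (fun j => U j) j x - procaDiffOp m U j x‖ =
        ‖(ε ^ 2 : ℝ) • (procaDiff ε m (fun j => U j) j x - procaDiffOp m U j x)‖ := by
      rw [norm_smul, Real.norm_of_nonneg (by positivity)]
    rw [h0, hsum]
    calc _ ≤ ∑ i, (K j * ε ^ 3 + K i * ε ^ 3) := by
          refine (norm_sum_le _ _).trans (Finset.sum_le_sum fun i _ => ?_)
          exact (norm_sub_le _ _).trans (add_le_add (h j ε x i i hε) (h i ε x i j hε))
      _ = (∑ i, (K j + K i)) * ε ^ 3 := by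
          rw [Finset.sum_mul]; exact Finset.sum_congr rfl fun i _ => by ring
      _ ≤ (∑ j, ∑ i, (K j + K i)) * ε ^ 3 := by
          refine mul_le_mul_of_nonneg_right ?_ (by positivity)
          exact Finset.single_le_sum (f := fun j => ∑ i, (K j + K i))
            (fun j _ => hKK j) (Finset.mem_univ j)
      _ = _ := by ring
  exact le_of_mul_le_mul_left hb (by positivity)

theorem lt_norm_latticePoint {ε R : ℝ} (hε : 0 < ε) (hε1 : ε < 1) {x : Space d}
    (hx : R + d < ‖x‖) : R < ‖latticePoint ε (site ε x)‖ := by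
  have h1 := norm_latticePoint_site_sub_le hε x
  have h2 := norm_sub_norm_le x (latticePoint ε (site ε x))
  rw [norm_sub_rev] at h2
  have h3 : ε * d ≤ d := mul_le_of_le_one_left (by positivity) hε1.le
  linarith

theorem lineDeriv_eq_zero_of_vanish {f : 𝓢(Space d, V)} {R : ℝ} (hf : ∀ x, R < ‖x‖ → f x = 0)
    (v : Space d) (x : Space d) (hx : R < ‖x‖) : (∂_{v} f) x = 0 := by
  rw [SchwartzMap.lineDerivOp_apply_eq_fderiv]
  have h1 : (f : Space d → V) =ᶠ[𝓝 x] fun _ => 0 := by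
    filter_upwards [continuous_norm.continuousAt.eventually (lt_mem_nhds hx)] with y hy
    exact hf y hy
  rw [h1.fderiv_eq]
  simp

/-- Moving `x` to its lattice point and replacing derivatives by differences each cost `O(ε)`
uniformly. For `ε < 1` all is supported in one ball: the radius grows by `2` for the stencil and by
`d` for the displacement within a cell. -/
theorem tendsto_l2norm_procaDiff {R : ℝ} (m : ℝ) {U : Fin d → 𝓢(Space d, V)}
    (hU : ∀ j x, R < ‖x‖ → U j x = 0) (j : Fin d) :
    Tendsto (fun ε => l2norm volume fun x => procaDiffOp m U j x -
      procaDiff ε m (fun j => U j) j (latticePoint ε (site ε x))) (𝓝[>] 0) (𝓝 0) := by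
  obtain ⟨K, hK, h⟩ := norm_procaDiff_sub_le m U
  obtain ⟨K', hK', h'⟩ := schwartz_lipschitz (procaDiffOp m U j)
  refine tendsto_l2norm_of_bound (K := K' * d + K) (R := R + 2 + d) (by positivity) ?_ ?_
  · intro ε x hε
    have h1 := h ε j (latticePoint ε (site ε x)) hε
    have h2 := (h' (latticePoint ε (site ε x)) x).trans (mul_le_mul_of_nonneg_left
      ((norm_sub_rev _ _).trans_le (norm_latticePoint_site_sub_le hε x)) hK')
    rw [norm_sub_rev] at h1
    refine (norm_sub_le_norm_sub_add_norm_sub _ (procaDiffOp m U j (latticePoint ε (site ε x)))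
      _).trans ((add_le_add h2 h1).trans_eq (by ring))
  · intro ε x hε hε1 hx
    have hd : (0 : ℝ) ≤ d := by positivity
    rw [procaDiff_eq_zero hε m hU j (by
      linarith [lt_norm_latticePoint (R := R + 2) hε hε1 hx]), sub_zero]
    have hx' : R < ‖x‖ := by linarith
    have h1 : ∀ i k l, (∂_{stdVec i} (∂_{stdVec k} (U l)) : 𝓢(Space d, V)) x = 0 := fun i k l =>
      lineDeriv_eq_zero_of_vanish (lineDeriv_eq_zero_of_vanish (hU l) _) _ x hx'
    simp [procaDiffOp, sum_apply, h1, hU j x hx']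

theorem tendsto_integral_inner_latticePoint [MeasurableSpace V] [BorelSpace V]
    [FiniteDimensional ℝ V] {R : ℝ} {u : 𝓢(Space d, V)} (hu : ∀ x, R < ‖x‖ → u x = 0)
    {f : Space d → V} (hf : MemLp f 2 volume) :
    Tendsto (fun ε => ∫ x, inner ℝ (u (latticePoint ε (site ε x))) (f x)) (𝓝[>] 0)
      (𝓝 (∫ x, inner ℝ (u x) (f x))) := by
  obtain ⟨K, hK, h⟩ := schwartz_lipschitz u
  have hd : (0 : ℝ) ≤ d := by positivity
  have h1 : Tendsto (fun ε => l2norm volume fun x => u (latticePoint ε (site ε x)) - u x)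
      (𝓝[>] 0) (𝓝 0) := by
    refine tendsto_l2norm_of_bound (K := K * d) (R := R + d) (by positivity) ?_ ?_
    · intro ε x hε
      refine (h x _).trans ((mul_le_mul_of_nonneg_left
        (norm_latticePoint_site_sub_le hε x) hK).trans_eq (by ring))
    · intro ε x hε hε1 hx
      rw [hu _ (lt_norm_latticePoint hε hε1 hx), hu x (by linarith), sub_zero]
  have h2 := h1.mul_const (l2norm volume f)
  rw [zero_mul] at h2
  rw [tendsto_iff_norm_sub_tendsto_zero]
  refine tendsto_of_tendsto_of_tendsto_of_le_of_le' tendsto_const_nhds h2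
    (Eventually.of_forall fun _ => norm_nonneg _) ?_
  filter_upwards [self_mem_nhdsWithin] with ε hε
  have i1 := memLp_comp_latticePoint (ε := ε) hε hu
  have i2 : MemLp u 2 volume := u.memLp 2
  rw [← integral_sub (integrable_inner_of_memLp i1 hf) (integrable_inner_of_memLp i2 hf)]
  simp_rw [← inner_sub_left]
  exact abs_integral_inner_le (i1.sub i2) hf

end ContinuumOperator

/-! ### The Proca operator solves the continuum equation -/

section ContinuumSolution

variable {d : ℕ}

theorem laplacian_eq_sum_stdVec {V : Type*} [NormedAddCommGroup V] [NormedSpace ℝ V]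
    (f : 𝓢(Space d, V)) : Δ f = ∑ i : Fin d, ∂_{stdVec i} (∂_{stdVec i} f) := by
  rw [SchwartzMap.laplacian_eq_sum (EuclideanSpace.basisFun (Fin d) ℝ)]
  simp [stdVec]

/-- `R_m` inverts `d* d + m`. -/
theorem procaDiffOp_procaOp {m : ℝ} (hm : 0 < m) (f : Fin d → 𝓢(Space d, ℝ)) (j : Fin d) :
    procaDiffOp m (procaOp m f) j = f j := by
  have hU : ∀ i, procaOp m f i =
      massiveInv m (f i) - m⁻¹ • ∂_{stdVec i} (massiveInv m (divergence f)) := fun i => by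
    rw [procaOp, map_sub, map_smul, massiveInv_lineDeriv hm]
  -- With `U = R_m F` and `K_m = (-Δ + m)⁻¹`, `div U = m⁻¹ (m - Δ) K_m div F = m⁻¹ div F`. Thus the
  -- term `∇ div U` in `d*d U = -Δ U + ∇ div U` restores exactly what `F - m⁻¹ ∇ div F` lacks.
  have hdiv : ∑ i, ∂_{stdVec i} (procaOp m f i) = m⁻¹ • divergence f := by
    simp_rw [hU, sub_eq_add_neg, LineDeriv.lineDerivOp_add, LineDeriv.lineDerivOp_neg,
      LineDeriv.lineDerivOp_smul, ← sub_eq_add_neg]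
    rw [Finset.sum_sub_distrib, ← Finset.smul_sum, ← laplacian_eq_sum_stdVec]
    have h1 : ∑ i, ∂_{stdVec i} (massiveInv m (f i)) = massiveInv m (divergence f) := by
      rw [divergence, map_sum]
      exact Finset.sum_congr rfl fun i _ => (massiveInv_lineDeriv hm _ _).symm
    have h2 := sub_laplacian_massiveInv hm (divergence f)
    rw [h1]
    conv_rhs => rw [← h2]
    rw [smul_sub, smul_smul, inv_mul_cancel₀ hm.ne', one_smul]
  have hlap := sub_laplacian_massiveInv hm (f j - m⁻¹ • ∂_{stdVec j} (divergence f))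
  change m • procaOp m f j - Δ (procaOp m f j) = _ at hlap
  rw [procaDiffOp, Finset.sum_sub_distrib, ← laplacian_eq_sum_stdVec]
  simp_rw [fun i => lineDeriv_comm (procaOp m f i) (stdVec i) (stdVec j)]
  rw [← LineDeriv.lineDerivOp_sum, hdiv, LineDeriv.lineDerivOp_smul]
  rw [sub_add_eq_add_sub, add_sub_assoc, hlap]
  abel

variable {n : ℕ} {V : Type*} [NormedAddCommGroup V] [InnerProductSpace ℝ V]

theorem procaDiffOp_postcomp (A : ℝ →L[ℝ] V) (m : ℝ) (f : Fin d → 𝓢(Space d, ℝ)) (j : Fin d) :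
    procaDiffOp m (fun i => (f i).postcompCLM A) j = (procaDiffOp m f j).postcompCLM A := by
  simp only [procaDiffOp, lineDeriv_postcomp, map_add, map_sub, map_sum, map_smul]

theorem procaDiffOp_sum {κ : Type*} [Fintype κ] (m : ℝ) (U : κ → Fin d → 𝓢(Space d, V))
    (j : Fin d) : procaDiffOp m (fun i => ∑ l, U l i) j = ∑ l, procaDiffOp m (U l) j := by
  simp only [procaDiffOp, LineDeriv.lineDerivOp_sum, Finset.sum_add_distrib,
    Finset.sum_sub_distrib, ← Finset.smul_sum]
  rw [Finset.sum_comm, Finset.sum_comm (f := fun i l => ∂_{stdVec i} (∂_{stdVec i} (U l j)))]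

/-- The form `R_m F` for a `V`-valued test form. -/
def procaSolution (m : ℝ) (b : OrthonormalBasis (Fin n) ℝ V) (F : TestForm d V) (j : Fin d) :
    𝓢(Space d, V) :=
  ∑ l, (procaOp m (F.coord b l) j).postcompCLM (ContinuousLinearMap.toSpanSingleton ℝ (b l))

theorem TestForm.coord_apply (F : TestForm d V) (b : OrthonormalBasis (Fin n) ℝ V) (l : Fin n)
    (j : Fin d) (x : Space d) : F.coord b l j x = inner ℝ (F.toFun j x) (b l) := rfl

theorem procaDiffOp_procaSolution {m : ℝ} (hm : 0 < m) (b : OrthonormalBasis (Fin n) ℝ V)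
    (F : TestForm d V) (j : Fin d) (x : Space d) :
    procaDiffOp m (procaSolution m b F) j x = F.toFun j x := by
  have h := procaDiffOp_sum m (fun l i => (procaOp m (F.coord b l) i).postcompCLM
    (ContinuousLinearMap.toSpanSingleton ℝ (b l))) j
  change procaDiffOp m (procaSolution m b F) j = _ at h
  rw [h, sum_apply]
  simp_rw [procaDiffOp_postcomp, procaDiffOp_procaOp hm, SchwartzMap.postcompCLM_apply,
    ContinuousLinearMap.toSpanSingleton_apply, TestForm.coord_apply]
  simp_rw [real_inner_comm (b _)]
  exact b.sum_repr' _

theorem sum_integral_inner_procaSolution (m : ℝ) (b : OrthonormalBasis (Fin n) ℝ V)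
    (F : TestForm d V) :
    ∑ j, ∫ x, inner ℝ (procaSolution m b F j x) (F.toFun j x) = procaVariance m b F := by
  rw [procaVariance]
  simp_rw [formInner]
  rw [Finset.sum_comm]
  refine Finset.sum_congr rfl fun j _ => ?_
  rw [← integral_finsetSum]
  · refine integral_congr_ae (Eventually.of_forall fun x => ?_)
    simp only [procaSolution, sum_apply, sum_inner, SchwartzMap.postcompCLM_apply,
      ContinuousLinearMap.toSpanSingleton_apply, real_inner_smul_left, TestForm.coord_apply]
    exact Finset.sum_congr rfl fun l _ => by rw [real_inner_comm, mul_comm]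
  · intro l _
    exact (SchwartzMap.pairing (ContinuousLinearMap.mul ℝ ℝ) _ _).integrable

end ContinuumSolution

/-! ### Cutting the solution off to compact support -/

section Cutoff

variable {d : ℕ} {V : Type*} [NormedAddCommGroup V] [InnerProductSpace ℝ V]

/-- The product of a scalar and a vector-valued Schwartz function. -/
def schwartzSMul (c : 𝓢(Space d, ℝ)) (f : 𝓢(Space d, V)) : 𝓢(Space d, V) :=
  SchwartzMap.pairing (ContinuousLinearMap.lsmul ℝ ℝ) c f

theorem schwartzSMul_apply (c : 𝓢(Space d, ℝ)) (f : 𝓢(Space d, V)) (x : Space d) :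
    schwartzSMul c f x = c x • f x := rfl

theorem lineDeriv_schwartzSMul (c : 𝓢(Space d, ℝ)) (f : 𝓢(Space d, V)) (v : Space d) :
    ∂_{v} (schwartzSMul c f) = schwartzSMul (∂_{v} c) f + schwartzSMul c (∂_{v} f) := by
  ext x
  have h : HasFDerivAt (schwartzSMul c f) _ x := (c.hasFDerivAt x).smul (f.hasFDerivAt x)
  rw [add_apply, schwartzSMul_apply, schwartzSMul_apply]
  simp only [SchwartzMap.lineDerivOp_apply_eq_fderiv]
  rw [h.fderiv]
  simp [add_comm]

/-- The function `x ↦ c (δ x)`. -/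
def dilate {δ : ℝ} (hδ : 0 < δ) (c : 𝓢(Space d, ℝ)) : 𝓢(Space d, ℝ) :=
  SchwartzMap.compCLMOfContinuousLinearEquiv ℝ
    (ContinuousLinearEquiv.smulLeft (Units.mk0 δ hδ.ne')) c

theorem dilate_apply {δ : ℝ} (hδ : 0 < δ) (c : 𝓢(Space d, ℝ)) (x : Space d) :
    dilate hδ c x = c (δ • x) := rfl

theorem lineDeriv_dilate {δ : ℝ} (hδ : 0 < δ) (c : 𝓢(Space d, ℝ)) (v : Space d) :
    ∂_{v} (dilate hδ c) = δ • dilate hδ (∂_{v} c) := by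
  rw [dilate, SchwartzMap.lineDerivOp_compCLMOfContinuousLinearEquiv]
  ext x
  have : ContinuousLinearEquiv.smulLeft (M₁ := Space d) (R₁ := ℝ) (Units.mk0 δ hδ.ne') v = δ • v :=
    rfl
  rw [this, lineDeriv_smul_left]
  rfl

theorem l2norm_schwartz_add_le [MeasurableSpace V] [BorelSpace V] [FiniteDimensional ℝ V]
    (f g : 𝓢(Space d, V)) :
    l2norm volume (f + g : 𝓢(Space d, V)) ≤ l2norm volume f + l2norm volume g :=
  l2norm_add_le (f.memLp 2) (g.memLp 2)

theorem l2norm_const_smul (r : ℝ) (f : Space d → V) :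
    l2norm volume (fun x => r • f x) = |r| * l2norm volume f := by
  simp only [l2norm, norm_smul, mul_pow, integral_const_mul]
  rw [Real.sqrt_mul (by positivity), Real.norm_eq_abs, Real.sqrt_sq (abs_nonneg r)]

theorem l2norm_schwartz_sum_le [MeasurableSpace V] [BorelSpace V] [FiniteDimensional ℝ V]
    {κ : Type*} (s : Finset κ) (f : κ → 𝓢(Space d, V)) :
    l2norm volume (∑ i ∈ s, f i : 𝓢(Space d, V)) ≤ ∑ i ∈ s, l2norm volume (f i) := by
  classical
  induction s using Finset.induction_on with
  | empty => simp [l2norm]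
  | insert a s ha ih =>
    rw [Finset.sum_insert ha, Finset.sum_insert ha]
    exact (l2norm_schwartz_add_le _ _).trans (by linarith)

/-- Dilation preserves the supremum of `c`, so the bound is uniform in `δ`. -/
theorem l2norm_schwartzSMul_dilate_le [MeasurableSpace V] [BorelSpace V] [FiniteDimensional ℝ V]
    (c : 𝓢(Space d, ℝ)) (f : 𝓢(Space d, V)) :
    ∃ K, 0 ≤ K ∧ ∀ {δ : ℝ} (hδ : 0 < δ), l2norm volume (schwartzSMul (dilate hδ c) f) ≤ K := by
  obtain ⟨K, hK, h⟩ := schwartz_bounded c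
  refine ⟨K * l2norm volume f, mul_nonneg hK (l2norm_nonneg _ _), fun {δ} hδ => ?_⟩
  rw [← abs_of_nonneg hK, ← l2norm_const_smul]
  refine Real.sqrt_le_sqrt (integral_mono_of_nonneg (Eventually.of_forall fun _ => by positivity)
    ?_ (Eventually.of_forall fun x => ?_))
  · exact (((f.memLp 2).const_smul K).integrable_norm_pow (by norm_num))
  · refine pow_le_pow_left₀ (norm_nonneg _) ?_ 2
    rw [schwartzSMul_apply, norm_smul, norm_smul, Real.norm_of_nonneg hK]
    exact mul_le_mul_of_nonneg_right (h _) (norm_nonneg _)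

theorem smul_schwartzSMul (r : ℝ) (c : 𝓢(Space d, ℝ)) (f : 𝓢(Space d, V)) :
    schwartzSMul (r • c) f = r • schwartzSMul c f := by
  ext x; simp [schwartzSMul_apply, mul_smul]

/-- By the Leibniz rule every surviving term has a derivative on the dilated cutoff, hence a factor
`δ` or `δ ^ 2`. -/
theorem l2norm_commutator_le [MeasurableSpace V] [BorelSpace V] [FiniteDimensional ℝ V]
    (c : 𝓢(Space d, ℝ)) (f : 𝓢(Space d, V)) (h k : Space d) : ∃ K, 0 ≤ K ∧
    ∀ {δ : ℝ} (hδ : 0 < δ), δ ≤ 1 → l2norm volume (∂_{h} (∂_{k} (schwartzSMul (dilate hδ c) f)) -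
      schwartzSMul (dilate hδ c) (∂_{h} (∂_{k} f)) : 𝓢(Space d, V)) ≤ K * δ := by
  obtain ⟨K₁, hK₁, h₁⟩ := l2norm_schwartzSMul_dilate_le (∂_{h} (∂_{k} c)) f
  obtain ⟨K₂, hK₂, h₂⟩ := l2norm_schwartzSMul_dilate_le (∂_{k} c) (∂_{h} f)
  obtain ⟨K₃, hK₃, h₃⟩ := l2norm_schwartzSMul_dilate_le (∂_{h} c) (∂_{k} f)
  refine ⟨K₁ + K₂ + K₃, by positivity, fun {δ} hδ hδ1 => ?_⟩
  have e : (∂_{h} (∂_{k} (schwartzSMul (dilate hδ c) f)) -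
      schwartzSMul (dilate hδ c) (∂_{h} (∂_{k} f)) : 𝓢(Space d, V)) =
      δ ^ 2 • schwartzSMul (dilate hδ (∂_{h} (∂_{k} c))) f +
      δ • schwartzSMul (dilate hδ (∂_{k} c)) (∂_{h} f) +
      δ • schwartzSMul (dilate hδ (∂_{h} c)) (∂_{k} f) := by
    simp only [lineDeriv_schwartzSMul, LineDeriv.lineDerivOp_add, lineDeriv_dilate,
      smul_schwartzSMul, LineDeriv.lineDerivOp_smul, smul_smul, ← pow_two, smul_add]
    abel
  rw [e]
  have l : ∀ (r : ℝ) (g : 𝓢(Space d, V)), 0 ≤ r →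
      l2norm volume (r • g : 𝓢(Space d, V)) = r * l2norm volume g := fun r g hr => by
    rw [← abs_of_nonneg hr, ← l2norm_const_smul, abs_of_nonneg hr]; rfl
  refine (l2norm_schwartz_add_le _ _).trans ?_
  refine (add_le_add_left (l2norm_schwartz_add_le _ _) _).trans ?_
  rw [l _ _ (by positivity), l _ _ hδ.le, l _ _ hδ.le]
  have a1 := mul_le_mul_of_nonneg_left (h₁ hδ) (by positivity : 0 ≤ δ ^ 2)
  have a2 := mul_le_mul_of_nonneg_left (h₂ hδ) hδ.le
  have a3 := mul_le_mul_of_nonneg_left (h₃ hδ) hδ.le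
  have a4 : δ ^ 2 * K₁ ≤ δ * K₁ := mul_le_mul_of_nonneg_right (by nlinarith) hK₁
  linarith

/-- The mass term commutes with the cutoff, so only commutators of second derivatives remain. -/
theorem l2norm_procaDiffOp_schwartzSMul_le [MeasurableSpace V] [BorelSpace V]
    [FiniteDimensional ℝ V] (m : ℝ) (c : 𝓢(Space d, ℝ)) (U : Fin d → 𝓢(Space d, V)) (j : Fin d) :
    ∃ K, 0 ≤ K ∧ ∀ {δ : ℝ} (hδ : 0 < δ), δ ≤ 1 →
      l2norm volume (procaDiffOp m (fun i => schwartzSMul (dilate hδ c) (U i)) j -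
        schwartzSMul (dilate hδ c) (procaDiffOp m U j) : 𝓢(Space d, V)) ≤ K * δ := by
  choose K₁ hK₁ h₁ using fun i => l2norm_commutator_le c (U i) (stdVec i) (stdVec j)
  choose K₂ hK₂ h₂ using fun i => l2norm_commutator_le c (U j) (stdVec i) (stdVec i)
  refine ⟨∑ i, (K₁ i + K₂ i), Finset.sum_nonneg fun i _ => add_nonneg (hK₁ i) (hK₂ i),
    fun {δ} hδ hδ1 => ?_⟩
  set C := dilate hδ c
  have e : (procaDiffOp m (fun i => schwartzSMul C (U i)) j -
        schwartzSMul C (procaDiffOp m U j) : 𝓢(Space d, V)) =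
      ∑ i, ((∂_{stdVec i} (∂_{stdVec j} (schwartzSMul C (U i))) -
        schwartzSMul C (∂_{stdVec i} (∂_{stdVec j} (U i)))) +
        (-1 : ℝ) • (∂_{stdVec i} (∂_{stdVec i} (schwartzSMul C (U j))) -
        schwartzSMul C (∂_{stdVec i} (∂_{stdVec i} (U j))))) := by
    ext x
    simp only [procaDiffOp, sub_apply, add_apply, sum_apply, smul_apply, schwartzSMul_apply,
      smul_add, Finset.smul_sum, smul_comm (C x) m, add_sub_add_right_eq_sub,
      ← Finset.sum_sub_distrib]
    refine Finset.sum_congr rfl fun i _ => ?_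
    module
  rw [e, Finset.sum_mul]
  refine (l2norm_schwartz_sum_le _ _).trans (Finset.sum_le_sum fun i _ => ?_)
  refine (l2norm_schwartz_add_le _ _).trans ?_
  rw [add_mul]
  refine add_le_add (h₁ i hδ hδ1) ?_
  refine le_trans (le_of_eq ?_) (h₂ i hδ hδ1)
  refine (l2norm_const_smul (-1) _).trans ?_
  simp
  rfl

/-- A form can be cut off to compact support in such a way that `d* d + m` applied to it changes
little in `L²`, if this is a form of compact support. -/
theorem exists_cutoff [MeasurableSpace V] [BorelSpace V] [FiniteDimensional ℝ V] (m : ℝ)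
    (U : Fin d → 𝓢(Space d, V)) {R : ℝ} (hR : ∀ j x, R < ‖x‖ → procaDiffOp m U j x = 0)
    {η : ℝ} (hη : 0 < η) : ∃ (T : ℝ) (W : Fin d → 𝓢(Space d, V)),
      (∀ j x, T < ‖x‖ → W j x = 0) ∧ (∀ j x, ‖x‖ ≤ R → W j x = U j x) ∧
      ∀ j, l2norm volume (fun x => procaDiffOp m U j x - procaDiffOp m W j x) ≤ η := by
  let bump : ContDiffBump (0 : Space d) := ⟨1, 2, one_pos, one_lt_two⟩
  let c : 𝓢(Space d, ℝ) := HasCompactSupport.toSchwartzMap (f := bump) bump.hasCompactSupport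
    bump.contDiff
  have hc : ∀ x, c x = bump x := fun x => rfl
  choose K hK h using l2norm_procaDiffOp_schwartzSMul_le m c U
  -- The scale of the cutoff: `1` gives `M⁻¹ ≤ 1`, `|R|` makes the cutoff equal to `1` on the ball
  -- of radius `R`, and the sum makes the error `K j * M⁻¹` at most `η`.
  set M := 1 + |R| + ∑ j, K j / η
  have hsum : ∀ j, K j / η ≤ ∑ j, K j / η := fun j =>
    Finset.single_le_sum (f := fun j => K j / η) (fun j _ => div_nonneg (hK j) hη.le)
      (Finset.mem_univ j)
  have hsum0 : 0 ≤ ∑ j, K j / η := Finset.sum_nonneg fun j _ => div_nonneg (hK j) hη.le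
  have hM1 : 1 ≤ M := by simp only [M]; linarith [abs_nonneg R]
  have hM : 0 < M := by linarith
  have hδ : 0 < M⁻¹ := inv_pos.2 hM
  have hδ1 : M⁻¹ ≤ 1 := inv_le_one_of_one_le₀ hM1
  have hone : ∀ x : Space d, ‖x‖ ≤ R → dilate hδ c x = 1 := by
    intro x hx
    rw [dilate_apply, hc]
    refine bump.one_of_mem_closedBall ?_
    rw [mem_closedBall_zero_iff, norm_smul, Real.norm_of_nonneg hδ.le, inv_mul_eq_div,
      div_le_iff₀ hM]
    change ‖x‖ ≤ 1 * M
    simp only [M]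
    linarith [le_abs_self R]
  refine ⟨2 * M, fun j => schwartzSMul (dilate hδ c) (U j), ?_, ?_, ?_⟩
  · intro j x hx
    rw [schwartzSMul_apply, dilate_apply, hc, bump.zero_of_le_dist, zero_smul]
    rw [dist_zero_right, norm_smul, Real.norm_of_nonneg hδ.le, inv_mul_eq_div, le_div_iff₀ hM]
    exact hx.le
  · intro j x hx
    simp only [schwartzSMul_apply, hone x hx, one_smul]
  · intro j
    -- Where the cutoff may differ from `1`, `procaDiffOp m U` vanishes, so multiplying it by the
    -- cutoff changes nothing and only the commutator is left.
    have e : (fun x => procaDiffOp m U j x -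
        procaDiffOp m (fun j => schwartzSMul (dilate hδ c) (U j)) j x) =
        fun x => (-1 : ℝ) • (procaDiffOp m (fun i => schwartzSMul (dilate hδ c) (U i)) j -
        schwartzSMul (dilate hδ c) (procaDiffOp m U j) : 𝓢(Space d, V)) x := by
      ext1 x
      rw [sub_apply, schwartzSMul_apply]
      rcases le_or_gt ‖x‖ R with hx | hx
      · rw [hone x hx]; module
      · rw [hR j x hx]; module
    rw [e, l2norm_const_smul]
    refine le_trans ?_ ((h j hδ hδ1).trans (?_ : _ ≤ η))
    · simp
    · rw [← div_eq_mul_inv, div_le_iff₀ hM, mul_comm, ← div_le_iff₀ hη]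
      simp only [M]
      linarith [hsum j, abs_nonneg R]

end Cutoff

/-! ### Convergence of the variance and the conclusion -/

section Main

variable {d n : ℕ} {V : Type*} [NormedAddCommGroup V] [InnerProductSpace ℝ V]

theorem TestForm.exists_radius (F : TestForm d V) :
    ∃ R, ∀ j x, R < ‖x‖ → F.toFun j x = 0 := by
  have h : ∀ j, ∃ R, ∀ x, R < ‖x‖ → F.toFun j x = 0 := fun j => by
    obtain ⟨R, hR⟩ := (F.compactSupport j).isCompact.isBounded.subset_closedBall 0
    refine ⟨R, fun x hx => image_eq_zero_of_notMem_tsupport fun hx' => ?_⟩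
    have := hR hx'
    rw [mem_closedBall_zero_iff] at this
    linarith
  choose R hR using h
  refine ⟨∑ j, |R j|, fun j x hx => hR j x (lt_of_le_of_lt ?_ hx)⟩
  exact (le_abs_self _).trans (Finset.single_le_sum (f := fun j => |R j|)
    (fun j _ => abs_nonneg _) (Finset.mem_univ j))

/-- `ε ^ (-1 - δ)` is `ε⁻¹` times the divergent factor `ε ^ (-δ)`, so the box eventually contains
any fixed ball at scale `ε`, with the margin `3`. The `4` in the proof allows for the floor. -/
theorem eventually_box_large {δ : ℝ} (hδ : 0 < δ) (T : ℝ) :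
    ∀ᶠ ε : ℝ in 𝓝[>] 0, T / ε + 3 ≤ ⌊ε ^ (-1 - δ)⌋₊ := by
  have h1 := (tendsto_rpow_neg_nhdsGT_zero (neg_neg_of_pos hδ)).eventually_ge_atTop (T + 4)
  filter_upwards [h1, self_mem_nhdsWithin, mem_nhdsWithin_of_mem_nhds (gt_mem_nhds one_pos)]
    with ε h hε hε1
  have hε : 0 < ε := hε
  have h2 : ε ^ (-1 - δ) = ε ^ (-δ) / ε := by
    rw [show -1 - δ = -δ - 1 by ring, Real.rpow_sub_one hε.ne']
  have h3 : T / ε + 4 ≤ ε ^ (-1 - δ) := by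
    rw [h2, le_div_iff₀ hε, add_mul, div_mul_cancel₀ _ hε.ne']
    linarith
  linarith [Nat.sub_one_lt_floor (ε ^ (-1 - δ))]

variable [FiniteDimensional ℝ V] [MeasurableSpace V] [BorelSpace V]

/-- The variance of the rescaled lattice field tested against `F` converges to that of the
continuum field. -/
theorem tendsto_pairing_variance {m δ : ℝ} (hm : 0 < m) (hδ : 0 < δ)
    (b : OrthonormalBasis (Fin n) ℝ V) (F : TestForm d V) {ι : Type*} {l : Filter ι} {ε : ι → ℝ}
    (hε : ∀ i, 0 < ε i) (hε0 : Tendsto ε l (𝓝 0))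
    (Y : ∀ i, edges d ⌊ε i ^ (-1 - δ)⌋₊ → V)
    (hY : ∀ i, actionForm d _ V (ε i ^ 2 * m) (Y i) = pairingLin _ (hε i) F) :
    Tendsto (fun i => pairingLin _ (hε i) F (Y i)) l (𝓝 (procaVariance m b F)) := by
  have hε' : Tendsto ε l (𝓝[>] 0) :=
    tendsto_nhdsWithin_iff.2 ⟨hε0, Eventually.of_forall hε⟩
  obtain ⟨R, hR⟩ := F.exists_radius
  have hPU := procaDiffOp_procaSolution hm b F
  set A := m⁻¹ * ∑ j, l2norm volume (F.toFun j)
  have hA : 0 ≤ A :=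
    mul_nonneg (inv_nonneg.2 hm.le) (Finset.sum_nonneg fun _ _ => l2norm_nonneg _ _)
  rw [Metric.tendsto_nhds]
  intro θ hθ
  -- The residual will be at most `(d + 1) * η`: `d` components of cutoff error and one `η` for all
  -- discretisation errors. The stability factor `A` then leaves at most `θ / 3`.
  set η := θ / (3 * (A + 1) * (d + 1))
  have hη : 0 < η := by positivity
  obtain ⟨T, W, hWT, hWU, hWF⟩ := exists_cutoff m (procaSolution m b F) (R := R)
    (fun j x hx => by rw [hPU, hR j x hx]) hη
  simp_rw [hPU] at hWF
  have hlim1 : Tendsto (fun ε => ∑ j, l2norm volume fun x => procaDiffOp m W j x -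
      procaDiff ε m (fun j => W j) j (latticePoint ε (site ε x))) (𝓝[>] 0) (𝓝 0) := by
    have := tendsto_finsetSum Finset.univ fun j _ => tendsto_l2norm_procaDiff m hWT j
    simpa using this
  have hlim2 : Tendsto (fun ε => ∑ j, ∫ x, inner ℝ (W j (latticePoint ε (site ε x)))
      (F.toFun j x)) (𝓝[>] 0) (𝓝 (procaVariance m b F)) := by
    -- The cutoff does not change the limit: `W` equals the solution wherever `F` is nonzero.
    have h1 : procaVariance m b F = ∑ j, ∫ x, inner ℝ (W j x) (F.toFun j x) := by
      rw [← sum_integral_inner_procaSolution]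
      refine Finset.sum_congr rfl fun j _ => integral_congr_ae (Eventually.of_forall fun x => ?_)
      rcases le_or_gt ‖x‖ R with hx | hx
      · simp only [hWU j x hx]
      · simp only [hR j x hx, inner_zero_right]
    rw [h1]
    exact tendsto_finsetSum Finset.univ fun j _ =>
      tendsto_integral_inner_latticePoint (hWT j) (F.memLp j)
  have e1 := hε'.eventually (hlim1.eventually (gt_mem_nhds hη))
  have e2 := hε'.eventually (hlim2.eventually (Metric.ball_mem_nhds _ (by positivity : 0 < θ / 3)))
  have e3 := hε'.eventually (eventually_box_large hδ T)
  filter_upwards [e1, e2, e3] with i h1 h2 h3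
  have h4 := abs_pairingLin_sub_le (hε i) hm hWT h3 F (hY i)
  have hD : ∀ j, MemLp (fun x => procaDiff (ε i) m (fun j => W j) j
      (latticePoint (ε i) (site (ε i) x))) 2 volume := fun j =>
    memLp_comp_latticePoint (hε i) fun x hx => procaDiff_eq_zero (hε i) m hWT j hx
  have h5 : (∑ j, l2norm volume fun x => F.toFun j x -
      procaDiff (ε i) m (fun j => W j) j (latticePoint (ε i) (site (ε i) x))) ≤ (d + 1) * η := by
    calc _ ≤ ∑ j, (l2norm volume (fun x => F.toFun j x - procaDiffOp m W j x) +
          l2norm volume fun x => procaDiffOp m W j x -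
            procaDiff (ε i) m (fun j => W j) j (latticePoint (ε i) (site (ε i) x))) := by
          refine Finset.sum_le_sum fun j _ => ?_
          refine le_of_eq_of_le ?_ (l2norm_add_le ((F.memLp j).sub ((procaDiffOp m W j).memLp 2))
            (((procaDiffOp m W j).memLp 2).sub (hD j)))
          simp
      _ ≤ d * η + η := by
          rw [Finset.sum_add_distrib]
          refine add_le_add ((Finset.sum_le_sum fun j _ => hWF j).trans ?_) h1.le
          simp
      _ = _ := by ring
  have h6 : A * ((d + 1) * η) ≤ θ / 3 := by
    have : A * ((d + 1) * η) = A / (A + 1) * (θ / 3) := by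
      simp only [η]; field_simp
    rw [this]
    exact mul_le_of_le_one_left (by positivity) ((div_le_one (by positivity)).2 (by linarith))
  have h7 := h4.trans ((mul_le_mul_of_nonneg_left h5 hA).trans h6)
  have h8 : |(∑ j, ∫ x, inner ℝ (W j (latticePoint (ε i) (site (ε i) x))) (F.toFun j x)) -
      procaVariance m b F| < θ / 3 := h2
  rw [Real.dist_eq]
  rw [abs_le] at h7
  rw [abs_lt] at h8 ⊢
  constructor <;> linarith

/-- Convergence in law of the rescaled lattice Proca field with values in a Euclidean space. -/
theorem tendstoInDistribution_rescaledPairing {m δ : ℝ} (hm : 0 < m) (hδ : 0 < δ)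
    (b : OrthonormalBasis (Fin n) ℝ V) (F : TestForm d V) {ι : Type*} {l : Filter ι}
    {ε β : ι → ℝ} (hε : ∀ i, 0 < ε i) (hβ : ∀ i, 0 < β i) (hε0 : Tendsto ε l (𝓝 0)) :
    TendstoInDistribution
      (fun i => rescaledPairing (L := ⌊ε i ^ (-1 - δ)⌋₊) (ε i) (β i) F) l (id : ℝ → ℝ)
      (fun i => (latticeProca d ⌊ε i ^ (-1 - δ)⌋₊ V
        (β := β i) (m := ε i ^ 2 * m) (hβ i) (mul_pos (pow_pos (hε i) 2) hm) : Measure _))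
      (procaLaw hm b F) := by
  choose Y hY using fun i => exists_actionForm_eq (mul_pos (pow_pos (hε i) 2) hm)
    (pairingLin (d := d) (V := V) ⌊ε i ^ (-1 - δ)⌋₊ (hε i) F)
  have hfun : ∀ i, (rescaledPairing (ε i) (β i) F : (edges d ⌊ε i ^ (-1 - δ)⌋₊ → V) → ℝ) =
      ⇑(√(β i) • pairingLin ⌊ε i ^ (-1 - δ)⌋₊ (hε i) F) := fun i =>
    funext fun X => rescaledPairing_eq (hε i) _ F X
  refine tendstoInDistribution_of_map_eq_gaussianReal ?_ (q := fun i => pairingLin _ (hε i) F (Y i))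
    ?_ (tendsto_pairing_variance hm hδ b F hε hε0 Y hY) ?_
  · intro i
    rw [hfun]
    exact (LinearMap.continuous_of_finiteDimensional
      (√(β i) • pairingLin _ (hε i) F)).measurable.aemeasurable
  · intro i
    -- The functional scaled by `√β` is represented by `√β • Y`, so the two factors cancel the `β`
    -- in the denominator of the variance.
    have h := map_latticeProca (hβ i) (mul_pos (pow_pos (hε i) 2) hm)
      (f := √(β i) • pairingLin _ (hε i) F) (Y := √(β i) • Y i) (by rw [map_smul, hY])
    have hq : (√(β i) • pairingLin _ (hε i) F) (√(β i) • Y i) / β i =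
        pairingLin _ (hε i) F (Y i) := by
      rw [LinearMap.smul_apply, map_smul, smul_smul, Real.mul_self_sqrt (hβ i).le, smul_eq_mul,
        mul_div_cancel_left₀ _ (hβ i).ne']
    rw [hq] at h
    rw [hfun]
    exact h
  · rw [procaLaw]
    congr 1
    exact NNReal.coe_injective (Real.coe_toNNReal _ (procaVariance_nonneg hm b F)).symm

end Main

end Proca

end

theorem proposition2p3
    {N : ℕ} (G : Subgroup (Matrix.unitaryGroup (Fin N) ℂ))
    (hGcompact : IsCompact (G : Set (Matrix.unitaryGroup (Fin N) ℂ)))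
    (hGconn : IsConnected (G : Set (Matrix.unitaryGroup (Fin N) ℂ)))
    {n : ℕ} (b : OrthonormalBasis (Fin n) ℝ (Proca.LieAlg G))
    {d : ℕ} (hd : 2 ≤ d) {m : ℝ} (hm : 0 < m) {δ : ℝ} (hδ : 0 < δ) {C : ℝ} (hC : 0 < C)
    {ι : Type*} (l : Filter ι) (ε β : ι → ℝ) (hε : ∀ i, 0 < ε i) (hβ : ∀ i, 0 < β i)
    (hε0 : Tendsto ε l (𝓝 0)) (hβtop : Tendsto β l atTop)
    (hβε : ∀ᶠ i in l, (β i)⁻¹ ≤ ε i ^ C)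
    (F : Proca.TestForm d (Proca.LieAlg G)) :
    TendstoInDistribution
      (fun i => Proca.rescaledPairing (L := ⌊ε i ^ (-1 - δ)⌋₊) (ε i) (β i) F) l
      (id : ℝ → ℝ)
      (fun i => (Proca.latticeProca d ⌊ε i ^ (-1 - δ)⌋₊ (Proca.LieAlg G)
        (β := β i) (m := ε i ^ 2 * m) (hβ i) (mul_pos (pow_pos (hε i) 2) hm) : Measure _))
      (Proca.procaLaw hm b F) :=
  Proca.tendstoInDistribution_rescaledPairing hm hδ b F hε hβ hε0
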